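/- Let $a<b$, $q\ge 0$, and let $r_1,\dots,r_q:[a,b]\to\mathbb R$ be continuous, smooth and positive on $(a,b)$, with $r_i(z)\ne r_j(z)$ for $i\neq j$ and $z\in(a,b)$, such that $$\Sigma=\{(r_i(z)\cos\theta,\ r_i(z)\sin\theta,\ z)\;:\;1\le i\le q,\ a\le z\le b,\ \theta\in\mathbb R\}\subset\mathbb R^3$$ is a smooth embedded surface without boundary (a compact axially symmetric surface on each sheet of which $(z,\theta)$ are coordinates for $a<z<b$; e.g. $q=1$ for an ellipsoid of revolution, $q=2$ for a torus of revolution). Let $g$ be the metric induced from $\mathbb R^3$ and $\Delta_g$ its Laplace–Beltrami operator, $\Delta_g f=|g|^{-1/2}\partial_i(|g|^{1/2}g^{ij}\partial_j f)$. Let $0<\beta\le 1$, $\hbar_N=(b-a)\beta/N$ and $z(n,m)=a+\hbar_N\frac{n+m}{2}$. For a function $f:\Sigma\to\mathbb C$ let $f^{(i)}_k(z)=\frac1{2\pi}\int_0^{2\pi}f(r_i(z)\cos\theta,r_i(z)\sin\theta,z)e^{-ik\theta}\,d\theta$, and let $$T_N(f)=\bigoplus_{i=1}^q\ \sum_{n,m=1}^N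 f^{(i)}_{n-m}(z(n,m))\,E_{n,m},$$ where $E_{n,m}$ are the matrix units (so $T_N(f)\in M_N(\mathbb C)$ if $q=1$). Put $X_j=T_N(x_j)$ for the coordinates $x_1,x_2,x_3$ of $\mathbb R^3$, $$\gamma_N=\sqrt{\sum_{i>j}-\Big(\frac{[X_i,X_j]}{\hbar_N}\Big)^2}\quad\text{(positive semidefinite root)},\qquad \Delta_N F=-\frac1{\hbar_N^2}\sum_{j=1}^3\gamma_N^{-1}\big[X_j,\gamma_N^{-1}[X_j,F]\big].$$ A sequence $(F_N)$ of matrices is said to converge to $f$ if $\|F_N-T_N(f)\|\to0$, where $\|\cdot\|$ is the operator norm. **Theorem.** Let $f\in C^\infty(\Sigma,\mathbb C)$ and $F_N=T_N(f)$ for all $N$, and suppose that $\Delta_NF_N=\lambda_NF_N$ for all sufficiently large $N$, where $\lambda_N\in\mathbb C$ and $\lambda_N\to\lambda$. Then $$\lim_{N\to\infty}\|T_N(\Delta_gf-\lambda f)\|=0,$$ $F_N$ converges to $f$, and $\Delta_gf=\lambda f$ at all points of $\Sigma$ with $z\le a+(b-a)\beta$. In particular, if $\beta=1$ (so that the grid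 fills $[a,b]$), then $\Delta_gf=\lambda f$ on all of $\Sigma$. If moreover $F_N\ne0$ for some $N$, then $f\neq 0$; thus, when $\beta=1$ and some $F_N\ne 0$, $F_N$ converges to an eigenfunction $f$ of $\Delta_g$ with eigenvalue $\lambda$. -/

import Mathlib

open Filter Topology Set
open scoped ContDiff MatrixOrder Matrix.Norms.L2Operator

noncomputable section

/-- Euclidean three-space, with coordinates `p 0 = x`, `p 1 = y`, `p 2 = z`. -/
abbrev E3 : Type := EuclideanSpace ℝ (Fin 3)

/-! ### Embedded surfaces and their Laplace-Beltrami operator -/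

/-- `S` is a smooth embedded surface without boundary: near each of its points it is the zero set
of a smooth function with nonvanishing differential. -/
def IsSmoothSurface (S : Set E3) : Prop :=
  ∀ p ∈ S, ∃ G : E3 → ℝ, ContDiff ℝ ∞ G ∧ fderiv ℝ G p ≠ 0 ∧ ∀ᶠ x in 𝓝 p, (x ∈ S ↔ G x = 0)

/-- The tangent plane of `S` at `p`, as a linear subspace of `ℝ³`. -/
def tangentPlane (S : Set E3) (p : E3) : Submodule ℝ E3 :=
  Submodule.span ℝ (tangentConeAt ℝ S p)

/-- The `j`-th component of the surface gradient of `f`, that is the derivative of `f` along `S` in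
the direction of the orthogonal projection of `eⱼ` to the tangent plane.  At points of a smooth
surface it depends only on the restriction of `f` to `S`. -/
def tangentialDeriv (S : Set E3) (j : Fin 3) (f : E3 → ℂ) (p : E3) : ℂ :=
  fderivWithin ℝ f S p ((tangentPlane S p).starProjection (EuclideanSpace.single j (1 : ℝ)))

/-- The Laplace-Beltrami operator of the metric that `S` inherits from `ℝ³`: the surface divergence
of the surface gradient, `Δ_g f = ∑ⱼ DⱼDⱼf` with the tangential derivatives `Dⱼ`.
It is the operator `|g|^{-1/2} ∂ᵢ(|g|^{1/2} gⁱʲ ∂ⱼ f)` in local coordinates (so it is nonpositive). -/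
def laplaceBeltrami (S : Set E3) (f : E3 → ℂ) (p : E3) : ℂ :=
  ∑ j : Fin 3, tangentialDeriv S j (tangentialDeriv S j f) p

/-! ### Axially symmetric surfaces -/

/-- The point with cylindrical coordinates `(ρ, θ, z)`. -/
def cylPoint (ρ θ z : ℝ) : E3 := !₂[ρ * Real.cos θ, ρ * Real.sin θ, z]

/-- A compact smooth surface embedded in `ℝ³`, symmetric under rotations about the `z`-axis, which
lies over `z ∈ [a, b]` and whose level sets with `a < z < b` consist of `q` circles, so that `(z, θ)`
are coordinates on each of the `q` sheets (`q = 1` for an ellipsoid of revolution, `q = 2` for a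
torus of revolution).  The `i`-th sheet is `(z, θ) ↦ (rᵢ(z) cos θ, rᵢ(z) sin θ, z)`. -/
structure AxialSurface (q : ℕ) where
  a : ℝ
  b : ℝ
  a_lt_b : a < b
  r : Fin q → ℝ → ℝ
  continuousOn_r : ∀ i, ContinuousOn (r i) (Icc a b)
  contDiffOn_r : ∀ i, ContDiffOn ℝ ∞ (r i) (Ioo a b)
  r_pos : ∀ i, ∀ z ∈ Ioo a b, 0 < r i z
  r_ne : ∀ i j, i ≠ j → ∀ z ∈ Ioo a b, r i z ≠ r j z
  isSmoothSurface :
    IsSmoothSurface {p : E3 | ∃ i, ∃ z ∈ Icc a b, ∃ θ : ℝ, p = cylPoint (r i z) θ z}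

namespace AxialSurface

variable {q : ℕ} (M : AxialSurface q)

/-- The surface as a subset of `ℝ³`. -/
def carrier : Set E3 :=
  {p : E3 | ∃ i, ∃ z ∈ Icc M.a M.b, ∃ θ : ℝ, p = cylPoint (M.r i z) θ z}

/-- The `k`-th Fourier coefficient of `f` on the circle at height `z` in the `i`-th sheet,
`(2π)⁻¹ ∫₀^{2π} f(rᵢ(z) cos θ, rᵢ(z) sin θ, z) e^{-ikθ} dθ`. -/
def coeff (f : E3 → ℂ) (i : Fin q) (k : ℤ) (z : ℝ) : ℂ :=
  fourierCoeffOn Real.two_pi_pos (fun θ : ℝ => f (cylPoint (M.r i z) θ z)) k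

/-- The quantization parameter `ħ_N = (b - a) β / N`. -/
def hbar (β : ℝ) (N : ℕ) : ℝ := (M.b - M.a) * β / N

/-- The height `z(n, m) = a + ħ_N (n + m) / 2`. -/
def height (β : ℝ) (N : ℕ) (n m : ℕ) : ℝ := M.a + M.hbar β N * ((n + m : ℝ) / 2)

/-- The quantization map: `T_N(f)` is the direct sum over the sheets of the `N × N` matrices
`∑_{n,m=1}^N f_{n-m}(z(n,m)) E_{n,m}`.  The index `s : Fin N` stands for `n = s + 1`. -/
def quantize (β : ℝ) (N : ℕ) (f : E3 → ℂ) : Matrix (Fin q × Fin N) (Fin q × Fin N) ℂ :=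
  Matrix.of fun u v =>
    if u.1 = v.1 then
      M.coeff f u.1 ((u.2 : ℤ) - (v.2 : ℤ)) (M.height β N ((u.2 : ℕ) + 1) ((v.2 : ℕ) + 1))
    else 0

/-- The quantized coordinates `X_j = T_N(x_j)`. -/
def X (β : ℝ) (N : ℕ) (j : Fin 3) : Matrix (Fin q × Fin N) (Fin q × Fin N) ℂ :=
  M.quantize β N fun p => ((p j : ℝ) : ℂ)

/-- `γ_N`, the positive semidefinite square root of `∑_{i > j} -([X_i, X_j] / ħ_N)²`. -/
def gammaMatrix (β : ℝ) (N : ℕ) : Matrix (Fin q × Fin N) (Fin q × Fin N) ℂ :=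
  CFC.sqrt (∑ i : Fin 3, ∑ j ∈ Finset.Iio i,
    -((((M.hbar β N : ℝ) : ℂ)⁻¹ • ⁅M.X β N i, M.X β N j⁆) ^ 2))

/-- The noncommutative Laplacian `Δ_N(F) = -ħ_N⁻² ∑ⱼ γ_N⁻¹ [X_j, γ_N⁻¹ [X_j, F]]`. -/
def ncLaplacian (β : ℝ) (N : ℕ) (F : Matrix (Fin q × Fin N) (Fin q × Fin N) ℂ) :
    Matrix (Fin q × Fin N) (Fin q × Fin N) ℂ :=
  -((((M.hbar β N : ℝ) : ℂ) ^ 2)⁻¹ •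
    ∑ j : Fin 3, (M.gammaMatrix β N)⁻¹ *
      ⁅M.X β N j, (M.gammaMatrix β N)⁻¹ * ⁅M.X β N j, F⁆⁆)

/-- A sequence of matrices `F_N` converges to the function `f` on the surface. -/
def ConvergesTo (β : ℝ) (F : (N : ℕ) → Matrix (Fin q × Fin N) (Fin q × Fin N) ℂ)
    (f : E3 → ℂ) : Prop :=
  Tendsto (fun N => ‖F N - M.quantize β N f‖) atTop (𝓝 0)

/-- `F_N = T_N(f)`, with `f` smooth on the surface, is an eigenmatrix sequence with eigenvalues
`lam N → l`.  (`ContDiffOn` on the surface is smoothness as a function on the surface.)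
The eigenvalue equation is required for large `N` only. -/
structure IsEigenmatrixSequence (β : ℝ)
    (F : (N : ℕ) → Matrix (Fin q × Fin N) (Fin q × Fin N) ℂ) (f : E3 → ℂ)
    (lam : ℕ → ℂ) (l : ℂ) : Prop where
  smooth : ContDiffOn ℝ ∞ f M.carrier
  eq_quantize : ∀ N, F N = M.quantize β N f
  eigen : ∀ᶠ N in atTop, M.ncLaplacian β N (F N) = lam N • F N
  tendsto : Tendsto lam atTop (𝓝 l)

end AxialSurface

end

/-!
Why the theorem is true. Only the entries of the matrices away from the ends of the grid matter.

Put `W = T_N(x₁ + i x₂)`, a weighted shift with weights `r(z(n, n-1))` on each sheet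
(`AxialSurface.shiftMatrix`). The third coordinate is quantized by a diagonal matrix, and
`γ_N² = (W W* + W* W) / 2 + (diagonal)²` is diagonal with positive entries for `N ≥ 2`
(`AxialSurface.sum_sq_lie_X`, `AxialSurface.gammaSq_pos`), so `γ_N` is invertible. Consequently
`Δ_N` preserves every diagonal `n - m = k`: away from the ends of the grid, the entry of
`Δ_N T_N(f)` at height `x = z(n, m)` is an explicit combination of the values of the Fourier
coefficient `f_k` at `x` and `x ± ħ_N` (`discreteSymbol`,
`AxialSurface.ncLaplacian_quantize_apply`). As `ħ_N → 0` and
`x → z₀ ∈ (a, b)`, it converges to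

  `f_k'' / (1 + r'²) + (r' / (r (1 + r'²)) - r' r'' / (1 + r'²)²) f_k' - k² f_k / r²`

(`tendsto_discreteSymbol`), and this is the `k`-th Fourier coefficient of `Δ_g f` on the circle at
height `z₀` (`AxialSurface.laplaceBeltrami_cylPoint`, `AxialSurface.coeff_laplaceBeltrami`). The
eigenvalue equation therefore gives `(Δ_g f)_k = λ f_k` at every height that is an interior limit of
grid points, and `Δ_g f = λ f` there, since a continuous function on a circle is determined by its
Fourier coefficients.

The circles over the endpoints, where `(z, θ)` need not be coordinates, are reached by continuity. A
smooth surface is a smooth local retract of `ℝ³` (`IsSmoothSurface.exists_retraction`), so that a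
smooth function on it extends locally to a smooth function on `ℝ³`; the tangential derivatives of
the extension are given by the projection along the gradient of a defining function, and `Δ_g f` is
continuous on the whole surface (`continuousOn_laplaceBeltrami`). Hence `Δ_g f = λ f` wherever
`z ≤ a + (b - a) β`. All heights `z(n, m)` lie in this range, so that the matrices
`T_N(Δ_g f - λ f)` are not merely small but zero.
-/

noncomputable section

/-! ### Difference quotients with moving base points -/

/-- Difference quotients of a strictly differentiable function, taken between two moving points. -/
lemma HasStrictDerivAt.tendsto_diffQuot {ι E : Type*} [NormedAddCommGroup E] [NormedSpace ℝ E]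
    {l : Filter ι} {φ : ℝ → E} {φ' : E} {x₀ δ : ℝ} {x y η : ι → ℝ} (hφ : HasStrictDerivAt φ φ' x₀)
    (hx : Tendsto x l (𝓝 x₀)) (hy : Tendsto y l (𝓝 x₀))
    (hxy : Tendsto (fun i => (x i - y i) / η i) l (𝓝 δ)) :
    Tendsto (fun i => (η i)⁻¹ • (φ (x i) - φ (y i))) l (𝓝 (δ • φ')) := by
  have hlim : Tendsto (fun i => (x i, y i)) l (𝓝 (x₀, x₀)) := by
    simpa [nhds_prod_eq] using hx.prodMk hy
  have ho := hφ.isLittleO.comp_tendsto hlim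
  have h1 : Tendsto (fun i => (η i)⁻¹ • (φ (x i) - φ (y i) - (x i - y i) • φ')) l (𝓝 0) := by
    have h2 : (fun i => (η i)⁻¹ • (φ (x i) - φ (y i) - (x i - y i) • φ')) =o[l]
        fun i => (η i)⁻¹ • (x i - y i) := by
      refine (Asymptotics.isBigO_refl (fun i => (η i)⁻¹) l).smul_isLittleO ?_
      simpa [Function.comp_def] using ho
    have h3 : Tendsto (fun i => (η i)⁻¹ • (x i - y i)) l (𝓝 δ) := by
      simpa [div_eq_inv_mul] using hxy
    exact (Asymptotics.isLittleO_one_iff ℝ).1 (h2.trans_isBigO (h3.isBigO_one ℝ))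
  have h4 := h1.add (hxy.smul_const φ')
  rw [zero_add] at h4
  refine h4.congr fun i => ?_
  rw [smul_sub _ (φ (x i) - φ (y i)), smul_smul, div_eq_inv_mul]
  abel

/-- Central second difference quotients at a moving base point. -/
lemma tendsto_second_diffQuot {ι E : Type*} [NormedAddCommGroup E] [NormedSpace ℝ E]
    {l : Filter ι} {h h₁ : ℝ → E} {h₂ : E} {x₀ : ℝ} {x η : ι → ℝ}
    (hh : ∀ᶠ t in 𝓝 x₀, HasDerivAt h (h₁ t) t) (hh₁ : HasStrictDerivAt h₁ h₂ x₀)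
    (hx : Tendsto x l (𝓝 x₀)) (hη : Tendsto η l (𝓝 0)) (hη' : ∀ᶠ i in l, 0 < η i) :
    Tendsto (fun i => (η i ^ 2)⁻¹ • (h (x i + η i) - h (x i) - (h (x i) - h (x i - η i)))) l
      (𝓝 h₂) := by
  rw [Metric.tendsto_nhds]
  intro ε hε
  have ho := hh₁.isLittleO.def (half_pos hε)
  rw [nhds_prod_eq] at ho
  obtain ⟨s, hs, hso⟩ := Filter.eventually_prod_self_iff'.1 ho
  obtain ⟨ρ, hρ, hball⟩ := Metric.mem_nhds_iff.1 (Filter.inter_mem hs hh)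
  have e1 : ∀ᶠ i in l, |x i - x₀| < ρ / 2 := by
    simpa [Real.dist_eq] using Metric.tendsto_nhds.1 hx (ρ / 2) (half_pos hρ)
  have e2 : ∀ᶠ i in l, |η i| < ρ / 2 := by
    simpa [Real.dist_eq] using Metric.tendsto_nhds.1 hη (ρ / 2) (half_pos hρ)
  filter_upwards [e1, e2, hη'] with i h1 h2 h3
  rw [abs_of_pos h3] at h2
  rw [abs_lt] at h1
  have mem : ∀ t, x i - η i ≤ t → t ≤ x i + η i → t ∈ Metric.ball x₀ ρ := by
    intro t ht ht'
    rw [Metric.mem_ball, Real.dist_eq, abs_lt]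
    constructor <;> linarith
  -- the mean value inequality for the first difference, corrected by its expected linear part
  have key := Convex.norm_image_sub_le_of_norm_hasDerivWithin_le
    (f := fun t => h (t + η i) - h t - (t * η i) • h₂)
    (f' := fun t => h₁ (t + η i) - h₁ t - η i • h₂) (s := Icc (x i - η i) (x i))
    (x := x i - η i) (y := x i) (C := ε / 2 * η i) ?_ ?_ (convex_Icc _ _) ?_ ?_
  · have e : (η i ^ 2)⁻¹ • (h (x i + η i) - h (x i) - (h (x i) - h (x i - η i))) - h₂ =
        (η i ^ 2)⁻¹ • (h (x i + η i) - h (x i) - (x i * η i) • h₂ -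
          (h (x i - η i + η i) - h (x i - η i) - ((x i - η i) * η i) • h₂)) := by
      rw [sub_add_cancel]
      have : h₂ = (η i ^ 2)⁻¹ • ((η i ^ 2) • h₂) := by
        rw [smul_smul, inv_mul_cancel₀ (by positivity), one_smul]
      conv_lhs => rw [this, ← smul_sub]
      congr 1
      module
    rw [dist_eq_norm, e, norm_smul, norm_inv, Real.norm_of_nonneg (by positivity)]
    rw [sub_sub_cancel, Real.norm_of_nonneg h3.le] at key
    calc _ ≤ (η i ^ 2)⁻¹ * (ε / 2 * η i * η i) := by gcongr
      _ = ε / 2 := by field_simp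
      _ < ε := half_lt_self hε
  · intro t ht
    have a1 := (hball (mem (t + η i) (by linarith [ht.1]) (by linarith [ht.2]))).2
    have a2 := (hball (mem t ht.1 (by linarith [ht.2]))).2
    have a3 : HasDerivAt (fun t => h (t + η i)) (h₁ (t + η i)) t :=
      HasDerivAt.comp_add_const t (η i) a1
    have a4 : HasDerivAt (fun t : ℝ => (t * η i) • h₂) (η i • h₂) t := by
      simpa using ((hasDerivAt_id t).mul_const (η i)).smul_const h₂
    exact ((a3.sub a2).sub a4).hasDerivWithinAt
  · intro t ht
    have a1 := (hball (mem (t + η i) (by linarith [ht.1]) (by linarith [ht.2]))).1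
    have a2 := (hball (mem t ht.1 (by linarith [ht.2]))).1
    have := hso _ a1 _ a2
    simpa [Real.norm_eq_abs, abs_of_pos h3] using this
  · exact ⟨le_rfl, by linarith⟩
  · exact ⟨by linarith, le_rfl⟩

/-! ### The scalar symbol of the noncommutative Laplacian -/

/-- The diagonal entries of `γ_N²` as a function of the height `x` and the quantization
parameter `η`. -/
def quantizedDensity (r : ℝ → ℝ) (η x : ℝ) : ℝ :=
  (r (x - η / 2) ^ 2 + r (x + η / 2) ^ 2) / 2
    + ((r (x + η / 2) ^ 2 - r (x - η / 2) ^ 2) / (2 * η)) ^ 2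

section SymbolLimits

variable {ι : Type*} {l : Filter ι} {r r₁ : ℝ → ℝ} {r₂ x₀ : ℝ} {x η : ι → ℝ}

lemma tendsto_add_mul_zero (hx : Tendsto x l (𝓝 x₀)) (hη : Tendsto η l (𝓝 0)) (α : ℝ) :
    Tendsto (fun i => x i + α * η i) l (𝓝 x₀) := by
  simpa using hx.add (hη.const_mul α)

lemma HasStrictDerivAt.tendsto_shift_diffQuot {E : Type*} [NormedAddCommGroup E]
    [NormedSpace ℝ E] {φ : ℝ → E} {φ' : E} (hφ : HasStrictDerivAt φ φ' x₀)
    (hx : Tendsto x l (𝓝 x₀)) (hη : Tendsto η l (𝓝 0)) (hη' : ∀ᶠ i in l, 0 < η i) (α β : ℝ) :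
    Tendsto (fun i => (η i)⁻¹ • (φ (x i + α * η i) - φ (x i + β * η i))) l
      (𝓝 ((α - β) • φ')) := by
  refine hφ.tendsto_diffQuot (tendsto_add_mul_zero hx hη α) (tendsto_add_mul_zero hx hη β) ?_
  refine tendsto_const_nhds.congr' ?_
  filter_upwards [hη'] with i hi
  field_simp
  ring

lemma tendsto_quantizedDensity (hr : HasStrictDerivAt r (r₁ x₀) x₀)
    (hx : Tendsto x l (𝓝 x₀)) (hη : Tendsto η l (𝓝 0)) (hη' : ∀ᶠ i in l, 0 < η i) :
    Tendsto (fun i => quantizedDensity r (η i) (x i)) l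
      (𝓝 (r x₀ ^ 2 * (1 + r₁ x₀ ^ 2))) := by
  have hR : HasStrictDerivAt (fun t => r t ^ 2) (2 * r x₀ * r₁ x₀) x₀ := by
    simpa using hr.fun_pow 2
  have hc : ContinuousAt r x₀ := hr.hasDerivAt.continuousAt
  have t1 := (hc.tendsto.comp (tendsto_add_mul_zero hx hη (-(1 / 2)))).pow 2
  have t2 := (hc.tendsto.comp (tendsto_add_mul_zero hx hη (1 / 2))).pow 2
  have t3 := hR.tendsto_shift_diffQuot hx hη hη' (1 / 2) (-(1 / 2))
  have t4 := ((t1.add t2).div_const 2).add ((t3.div_const 2).pow 2)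
  have e : (r x₀ ^ 2 + r x₀ ^ 2) / 2 + ((1 / 2 - -(1 / 2) : ℝ) • (2 * r x₀ * r₁ x₀) / 2) ^ 2
      = r x₀ ^ 2 * (1 + r₁ x₀ ^ 2) := by
    simp only [smul_eq_mul]; ring
  rw [e] at t4
  refine t4.congr fun i => ?_
  simp only [Function.comp_apply, quantizedDensity, smul_eq_mul]
  have e1 : x i + -(1 / 2) * η i = x i - η i / 2 := by ring
  have e2 : x i + 1 / 2 * η i = x i + η i / 2 := by ring
  rw [e1, e2]
  congr 2
  rw [inv_mul_eq_div, div_div, mul_comm (η i)]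

lemma tendsto_quantizedDensity_diffQuot (hr : ∀ᶠ t in 𝓝 x₀, HasDerivAt r (r₁ t) t)
    (hr₁ : HasStrictDerivAt r₁ r₂ x₀)
    (hx : Tendsto x l (𝓝 x₀)) (hη : Tendsto η l (𝓝 0)) (hη' : ∀ᶠ i in l, 0 < η i) :
    Tendsto (fun i => (η i)⁻¹ •
        (quantizedDensity r (η i) (x i + η i) - quantizedDensity r (η i) (x i))) l
      (𝓝 (2 * r x₀ * r₁ x₀ * (1 + r₁ x₀ ^ 2 + r x₀ * r₂))) := by
  have hrs : HasStrictDerivAt r (r₁ x₀) x₀ :=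
    hasStrictDerivAt_of_hasDerivAt_of_continuousAt hr hr₁.hasDerivAt.continuousAt
  have hR : HasStrictDerivAt (fun t => r t ^ 2) (2 * r x₀ * r₁ x₀) x₀ := by
    simpa using hrs.fun_pow 2
  have hR' : ∀ᶠ t in 𝓝 x₀, HasDerivAt (fun t => r t ^ 2) (2 * r t * r₁ t) t := by
    filter_upwards [hr] with t ht
    simpa using ht.fun_pow 2
  have hR₁ : HasStrictDerivAt (fun t => 2 * r t * r₁ t)
      (2 * r₁ x₀ * r₁ x₀ + 2 * r x₀ * r₂) x₀ := (hrs.const_mul 2).mul hr₁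
  have t1 := hR.tendsto_shift_diffQuot hx hη hη' (1 / 2) (-(1 / 2))
  have t2 := hR.tendsto_shift_diffQuot hx hη hη' (3 / 2) (1 / 2)
  have t3 := tendsto_second_diffQuot hR' hR₁ (tendsto_add_mul_zero hx hη (1 / 2)) hη hη'
  have t4 := ((t1.add t2).div_const 2).add ((t3.mul (t2.add t1)).div_const 4)
  have e : ((1 / 2 - -(1 / 2) : ℝ) • (2 * r x₀ * r₁ x₀) +
      (3 / 2 - 1 / 2 : ℝ) • (2 * r x₀ * r₁ x₀)) / 2
      + (2 * r₁ x₀ * r₁ x₀ + 2 * r x₀ * r₂) * ((3 / 2 - 1 / 2 : ℝ) • (2 * r x₀ * r₁ x₀)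
        + (1 / 2 - -(1 / 2) : ℝ) • (2 * r x₀ * r₁ x₀)) / 4
      = 2 * r x₀ * r₁ x₀ * (1 + r₁ x₀ ^ 2 + r x₀ * r₂) := by
    simp only [smul_eq_mul]; ring
  rw [e] at t4
  refine t4.congr' ?_
  filter_upwards [hη'] with i hi
  simp only [quantizedDensity, smul_eq_mul]
  have e1 : x i + -(1 / 2) * η i = x i - η i / 2 := by ring
  have e2 : x i + 1 / 2 * η i = x i + η i / 2 := by ring
  have e3 : x i + 3 / 2 * η i = x i + η i + η i / 2 := by ring
  have e4 : x i + η i / 2 + η i = x i + η i + η i / 2 := by ring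
  have e5 : x i + η i / 2 - η i = x i - η i / 2 := by ring
  have e6 : x i + η i - η i / 2 = x i + η i / 2 := by ring
  rw [e1, e2, e3, e4, e5, e6]
  field_simp
  ring

/-- The entry of `Δ_N T_N(f)` at height `x` on the `k`-th diagonal, as a function of the
quantization parameter `η`; here `c` is the `k`-th Fourier coefficient of `f`. -/
def discreteSymbol (r : ℝ → ℝ) (c : ℝ → ℂ) (k η x : ℝ) : ℂ :=
  let B : ℝ → ℝ := fun j => (√(quantizedDensity r η (x + k / 2 * η + j * η)))⁻¹
  let w : ℝ → ℝ := fun α => r (x + α * η);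
  -((k ^ 2 * B 0 ^ 2) • c x) - (B 0 * (2 * η ^ 2)⁻¹) •
    ((w ((k + 1) / 2) ^ 2 * B 1 + w (-(k + 1) / 2) ^ 2 * B 0
        + w ((k - 1) / 2) ^ 2 * B (-1) + w (-(k - 1) / 2) ^ 2 * B 0) • c x
      - (w ((k + 1) / 2) * w (-(k - 1) / 2) * (B 1 + B 0)) • c (x + η)
      - (w ((k - 1) / 2) * w (-(k + 1) / 2) * (B 0 + B (-1))) • c (x - η))

/-- The discrete symbol converges to the `k`-th Fourier mode of the Laplace-Beltrami operator of
the surface of revolution with profile `r`. -/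
theorem tendsto_discreteSymbol {c c₁ : ℝ → ℂ} {c₂ : ℂ} (k : ℝ) (hr0 : 0 < r x₀)
    (hr : ∀ᶠ t in 𝓝 x₀, HasDerivAt r (r₁ t) t) (hr₁ : HasStrictDerivAt r₁ r₂ x₀)
    (hc : ∀ᶠ t in 𝓝 x₀, HasDerivAt c (c₁ t) t) (hc₁ : HasStrictDerivAt c₁ c₂ x₀)
    (hx : Tendsto x l (𝓝 x₀)) (hη : Tendsto η l (𝓝 0)) (hη' : ∀ᶠ i in l, 0 < η i) :
    Tendsto (fun i => discreteSymbol r c k (η i) (x i)) l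
      (𝓝 ((1 + r₁ x₀ ^ 2)⁻¹ • c₂
        + (r₁ x₀ / (r x₀ * (1 + r₁ x₀ ^ 2)) - r₁ x₀ * r₂ / (1 + r₁ x₀ ^ 2) ^ 2) • c₁ x₀
        - (k ^ 2 / r x₀ ^ 2) • c x₀)) := by
  have hrs : HasStrictDerivAt r (r₁ x₀) x₀ :=
    hasStrictDerivAt_of_hasDerivAt_of_continuousAt hr hr₁.hasDerivAt.continuousAt
  have hcs : HasStrictDerivAt c (c₁ x₀) x₀ :=
    hasStrictDerivAt_of_hasDerivAt_of_continuousAt hc hc₁.hasDerivAt.continuousAt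
  set s : ℝ := 1 + r₁ x₀ ^ 2 with hs
  have hs0 : 0 < s := by positivity
  set g : ℝ := r x₀ ^ 2 * s with hg
  have hg0 : 0 < g := by positivity
  set g' : ℝ := 2 * r x₀ * r₁ x₀ * (s + r x₀ * r₂) with hg'
  set b : ℝ := (√g)⁻¹ with hb
  have hb0 : 0 < b := by positivity
  have hbb : b ^ 2 = g⁻¹ := by rw [hb, inv_pow, Real.sq_sqrt hg0.le]
  -- the limit of the difference quotients of `γ⁻¹`
  set b' : ℝ := -g' * b / (2 * g) with hb'
  have hφ : HasStrictDerivAt (fun t : ℝ => (√t)⁻¹) (-b / (2 * g)) g := by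
    have := (hasStrictDerivAt_inv (Real.sqrt_pos.2 hg0).ne').comp g
        (Real.hasStrictDerivAt_sqrt hg0.ne')
    have e : -(√g ^ 2)⁻¹ * (1 / (2 * √g)) = -b / (2 * g) := by
      rw [hb, Real.sq_sqrt hg0.le]
      field_simp
    rwa [e] at this
  have hxk : ∀ j : ℝ, Tendsto (fun i => x i + k / 2 * η i + j * η i) l (𝓝 x₀) := fun j =>
    tendsto_add_mul_zero (tendsto_add_mul_zero hx hη _) hη j
  have hD : ∀ j : ℝ, Tendsto (fun i => quantizedDensity r (η i) (x i + k / 2 * η i + j * η i)) l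
      (𝓝 g) := fun j => tendsto_quantizedDensity hrs (hxk j) hη hη'
  have hB : ∀ j : ℝ, Tendsto
      (fun i => (√(quantizedDensity r (η i) (x i + k / 2 * η i + j * η i)))⁻¹) l (𝓝 b) := fun j =>
    (hφ.hasDerivAt.continuousAt.tendsto.comp (hD j))
  have hdB : ∀ j : ℝ, Tendsto (fun i => (η i)⁻¹ •
      ((√(quantizedDensity r (η i) (x i + k / 2 * η i + (j + 1) * η i)))⁻¹
        - (√(quantizedDensity r (η i) (x i + k / 2 * η i + j * η i)))⁻¹)) l (𝓝 b') := by
    intro j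
    have := hφ.tendsto_diffQuot (η := η) (hD (j + 1)) (hD j) (δ := g') ?_
    · have e : g' • (-b / (2 * g)) = b' := by rw [hb', smul_eq_mul]; ring
      rwa [e] at this
    · have := tendsto_quantizedDensity_diffQuot hr hr₁ (hxk j) hη hη'
      refine this.congr fun i => ?_
      rw [smul_eq_mul, inv_mul_eq_div, add_one_mul, add_assoc]
  have hw : ∀ α : ℝ, Tendsto (fun i => r (x i + α * η i)) l (𝓝 (r x₀)) := fun α =>
    hrs.hasDerivAt.continuousAt.tendsto.comp (tendsto_add_mul_zero hx hη α)
  have hdw := hrs.tendsto_shift_diffQuot hx hη hη'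
  have hcx : Tendsto (fun i => c (x i)) l (𝓝 (c x₀)) :=
    hcs.hasDerivAt.continuousAt.tendsto.comp hx
  have hdc := hcs.tendsto_shift_diffQuot hx hη hη' 1 0
  have hddc := tendsto_second_diffQuot hc hc₁ hx hη hη'
  have hB0 := hB 0
  have hB1 := hB 1
  have hB2 := hB (-1)
  have hdB0 := hdB 0
  have hdB1 := hdB (-1)
  rw [zero_add] at hdB0
  rw [neg_add_cancel] at hdB1
  -- the coefficient of `c`
  have h1 := (hdw ((k + 1) / 2) (-(k - 1) / 2)).mul
    (((hdw ((k + 1) / 2) (-(k - 1) / 2)).mul hB1).add ((hw (-(k - 1) / 2)).mul hdB0))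
  have h2 := (hdw ((k - 1) / 2) (-(k + 1) / 2)).mul
    (((hdw ((k - 1) / 2) (-(k + 1) / 2)).mul hB2).sub ((hw (-(k + 1) / 2)).mul hdB1))
  have h3 := (((hB0.pow 2).const_mul (k ^ 2)).add
    ((hB0.div_const 2).mul (h1.add h2))).smul hcx
  -- the coefficient of the first difference of `c`
  have h4 := (((hw ((k + 1) / 2)).mul (hdw (-(k - 1) / 2) (-(k + 1) / 2))).add
      ((hw (-(k + 1) / 2)).mul (hdw ((k + 1) / 2) ((k - 1) / 2)))).mul (hB1.add hB0)
  have h5 := (((hw ((k - 1) / 2)).mul (hw (-(k + 1) / 2))).mul (hdB0.add hdB1))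
  have h6 := ((hB0.div_const 2).mul (h4.add h5)).smul hdc
  -- the coefficient of the second difference of `c`
  have h7 := ((hB0.div_const 2).mul
    (((hw ((k - 1) / 2)).mul (hw (-(k + 1) / 2))).mul (hB0.add hB2))).smul hddc
  have h8 := (h7.add h6).sub h3
  refine Tendsto.congr' ?_ (h8.trans_eq ?_)
  · filter_upwards [hη'] with i hi
    simp only [discreteSymbol, one_mul, zero_mul, add_zero]
    generalize (√(quantizedDensity r (η i) (x i + k / 2 * η i)))⁻¹ = B₀
    generalize (√(quantizedDensity r (η i) (x i + k / 2 * η i + η i)))⁻¹ = B₁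
    generalize (√(quantizedDensity r (η i) (x i + k / 2 * η i + -1 * η i)))⁻¹ = B₂
    generalize r (x i + (k + 1) / 2 * η i) = w₁
    generalize r (x i + (k - 1) / 2 * η i) = w₂
    generalize r (x i + -(k + 1) / 2 * η i) = w₃
    generalize r (x i + -(k - 1) / 2 * η i) = w₄
    simp only [smul_eq_mul, Complex.real_smul]
    have : (η i : ℂ) ≠ 0 := by exact_mod_cast hi.ne'
    push_cast
    field_simp
    ring
  · have hb4 : b * b' = -g' * b ^ 2 / (2 * g) := by rw [hb']; ring
    have e1 : b / 2 * (r x₀ * r x₀ * (b + b)) = s⁻¹ := by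
      have : b / 2 * (r x₀ * r x₀ * (b + b)) = r x₀ ^ 2 * b ^ 2 := by ring
      rw [this, hbb, hg]
      field_simp
    have e2 : b / 2 * ((r x₀ * (-(k - 1) / 2 - -(k + 1) / 2) • r₁ x₀
        + r x₀ * ((k + 1) / 2 - (k - 1) / 2) • r₁ x₀) * (b + b) + r x₀ * r x₀ * (b' + b'))
        = r₁ x₀ / (r x₀ * s) - r₁ x₀ * r₂ / s ^ 2 := by
      have : b / 2 * ((r x₀ * (-(k - 1) / 2 - -(k + 1) / 2) • r₁ x₀
          + r x₀ * ((k + 1) / 2 - (k - 1) / 2) • r₁ x₀) * (b + b) + r x₀ * r x₀ * (b' + b'))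
          = 2 * r x₀ * r₁ x₀ * b ^ 2 + r x₀ ^ 2 * (b * b') := by
        simp only [smul_eq_mul]; ring
      rw [this, hb4, hbb, hg', hg]
      field_simp
      ring
    have e3 : k ^ 2 * b ^ 2 + b / 2 *
        (((k + 1) / 2 - -(k - 1) / 2) • r₁ x₀ *
            (((k + 1) / 2 - -(k - 1) / 2) • r₁ x₀ * b + r x₀ * b') +
          ((k - 1) / 2 - -(k + 1) / 2) • r₁ x₀ *
            (((k - 1) / 2 - -(k + 1) / 2) • r₁ x₀ * b - r x₀ * b')) = k ^ 2 / r x₀ ^ 2 := by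
      have : k ^ 2 * b ^ 2 + b / 2 *
        (((k + 1) / 2 - -(k - 1) / 2) • r₁ x₀ *
            (((k + 1) / 2 - -(k - 1) / 2) • r₁ x₀ * b + r x₀ * b') +
          ((k - 1) / 2 - -(k + 1) / 2) • r₁ x₀ *
            (((k - 1) / 2 - -(k + 1) / 2) • r₁ x₀ * b - r x₀ * b')) = k ^ 2 * s * b ^ 2 := by
        simp only [smul_eq_mul, hs]; ring
      rw [this, hbb, hg]
      field_simp
    rw [e1, e2, e3, sub_zero, one_smul]

end SymbolLimits

/-! ### Tangential calculus on embedded surfaces -/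

/-- The gradient of `G`, written in coordinates. -/
def coordGradient (G : E3 → ℝ) (p : E3) : E3 :=
  ∑ i, fderiv ℝ G p (EuclideanSpace.single i 1) • EuclideanSpace.single i 1

lemma inner_coordGradient (G : E3 → ℝ) (p w : E3) :
    inner ℝ (coordGradient G p) w = fderiv ℝ G p w := by
  have hw : w = ∑ i, w i • EuclideanSpace.single i (1 : ℝ) := by
    ext j; fin_cases j <;> simp [Fin.sum_univ_three]
  conv_rhs => rw [hw]
  simp only [coordGradient, map_sum, map_smul, sum_inner, inner_smul_left,
    EuclideanSpace.inner_single_left]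
  simp [mul_comm]

lemma coordGradient_ne_zero {G : E3 → ℝ} {p : E3} (hG : fderiv ℝ G p ≠ 0) :
    coordGradient G p ≠ 0 := by
  intro h
  apply hG
  ext w
  simp [← inner_coordGradient, h]

lemma fderiv_coordGradient_ne_zero {G : E3 → ℝ} {p : E3} (hG : fderiv ℝ G p ≠ 0) :
    fderiv ℝ G p (coordGradient G p) ≠ 0 := by
  rw [← inner_coordGradient]
  exact inner_self_ne_zero.2 (coordGradient_ne_zero hG)

/-- Local smooth retraction onto a smooth surface: with `v` transverse to the surface and `ℓ = dG`
normalized by `ℓ v = 1`, the map `Φ x = x - ℓ (x - p) v + G x v` is tangent to the identity at `p`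
and straightens the surface to the plane `ℓ (x - p) = 0`. -/
lemma IsSmoothSurface.exists_retraction {S : Set E3} {p : E3} {G : E3 → ℝ} (hp : p ∈ S)
    (hG : ContDiff ℝ ∞ G) (hG' : fderiv ℝ G p ≠ 0) (hS : ∀ᶠ x in 𝓝 p, (x ∈ S ↔ G x = 0)) :
    ∃ (ρ : E3 → E3) (ρ' : E3 →L[ℝ] E3), ContDiffAt ℝ ∞ ρ p ∧ ρ p = p ∧ (∀ᶠ x in 𝓝 p, ρ x ∈ S) ∧
      (∀ᶠ x in 𝓝 p, x ∈ S → ρ x = x) ∧ HasFDerivAt ρ ρ' p ∧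
      ∀ w, fderiv ℝ G p w = 0 → ρ' w = w := by
  obtain ⟨v₀, hv₀⟩ : ∃ v, fderiv ℝ G p v ≠ 0 := by
    by_contra! h
    exact hG' (ContinuousLinearMap.ext h)
  set ℓ := fderiv ℝ G p with hℓ
  obtain ⟨v, hv⟩ : ∃ v, ℓ v = 1 := ⟨(ℓ v₀)⁻¹ • v₀, by simp [hv₀]⟩
  have hGp : G p = 0 := hS.self_of_nhds.1 hp
  set Φ : E3 → E3 := fun x => x - ℓ (x - p) • v + G x • v with hΦ
  have hΦc : ContDiff ℝ ∞ Φ := by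
    refine (contDiff_id.sub ((ℓ.contDiff.comp (contDiff_id.sub contDiff_const)).smul
      contDiff_const)).add (hG.smul contDiff_const)
  have hΦp : Φ p = p := by simp [hΦ, hGp]
  have hlin : ∀ x, HasFDerivAt (fun x : E3 => x - ℓ (x - p) • v)
      (ContinuousLinearMap.id ℝ E3 - ℓ.smulRight v) x := by
    intro x
    have h1 : HasFDerivAt (fun x : E3 => ℓ (x - p)) ℓ x :=
      ℓ.hasFDerivAt.comp x ((hasFDerivAt_id x).sub_const p)
    exact (hasFDerivAt_id x).sub (h1.smul_const v)
  have hΦ' : HasFDerivAt Φ ((ContinuousLinearEquiv.refl ℝ E3 : E3 ≃L[ℝ] E3) : E3 →L[ℝ] E3) p := by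
    have h2 : HasFDerivAt G ℓ p := (hG.differentiable (by simp)).differentiableAt.hasFDerivAt
    convert! (hlin p).add (h2.smul_const v) using 1
    ext; simp
  have hs := hΦc.contDiffAt.hasStrictFDerivAt' (x := p) hΦ' (by simp)
  set Ψ := hs.localInverse with hΨ
  have hΨc : ContDiffAt ℝ ∞ Ψ p := by
    have := hΦc.contDiffAt.to_localInverse (a := p) hΦ' (by simp)
    rwa [hΦp] at this
  have hΨp : Ψ p = p := by
    have := hs.localInverse_apply_image
    rwa [hΦp] at this
  have hΨ' : HasFDerivAt Ψ (ContinuousLinearMap.id ℝ E3) p := by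
    have := hs.to_localInverse.hasFDerivAt
    rw [hΦp] at this
    exact this
  have hleft : ∀ᶠ x in 𝓝 p, Ψ (Φ x) = x := hs.eventually_left_inverse
  have hright : ∀ᶠ x in 𝓝 p, Φ (Ψ x) = x := by
    have := hs.eventually_right_inverse
    rwa [hΦp] at this
  set A : E3 → E3 := fun x => x - ℓ (x - p) • v with hA
  have hAp : A p = p := by simp [hA]
  have hAc : ContDiff ℝ ∞ A :=
    contDiff_id.sub ((ℓ.contDiff.comp (contDiff_id.sub contDiff_const)).smul contDiff_const)
  have hAt : Tendsto A (𝓝 p) (𝓝 p) := by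
    have := hAc.continuous.tendsto p
    rwa [hAp] at this
  have hΨt : Tendsto Ψ (𝓝 p) (𝓝 p) := by
    have := hΨc.continuousAt.tendsto
    rwa [hΨp] at this
  refine ⟨Ψ ∘ A, (ContinuousLinearMap.id ℝ E3).comp (ContinuousLinearMap.id ℝ E3 - ℓ.smulRight v),
    ContDiffAt.comp p (by rwa [hAp]) hAc.contDiffAt, by simp [hAp, hΨp], ?_, ?_, ?_, ?_⟩
  · filter_upwards [hAt.eventually hright, (hΨt.comp hAt).eventually hS] with x hx hxS
    rw [hxS]
    have h3 : ℓ (Φ (Ψ (A x)) - p) = G (Ψ (A x)) := by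
      simp only [hΦ, map_sub, map_add, map_smul, hv, smul_eq_mul]
      ring
    rw [Function.comp_apply, ← h3, hx, hA]
    simp [hv]
  · filter_upwards [hleft, hS] with x hx hxS hmem
    have : A x = Φ x := by simp [hA, hΦ, hxS.1 hmem]
    rw [Function.comp_apply, this, hx]
  · exact HasFDerivAt.comp p (by rwa [hAp]) (hlin p)
  · intro w hw
    simp [hw]

/-- The tangent plane of a level set is the kernel of the differential. -/
lemma mem_tangentPlane_iff {S : Set E3} {p : E3} {G : E3 → ℝ} (hp : p ∈ S)
    (hG : ContDiff ℝ ∞ G) (hG' : fderiv ℝ G p ≠ 0) (hS : ∀ᶠ x in 𝓝 p, (x ∈ S ↔ G x = 0)) {w : E3} :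
    w ∈ tangentPlane S p ↔ fderiv ℝ G p w = 0 := by
  constructor
  · intro hw
    have hle : tangentPlane S p ≤ LinearMap.ker (fderiv ℝ G p : E3 →ₗ[ℝ] ℝ) := by
      rw [tangentPlane, Submodule.span_le]
      intro u hu
      have hd : HasFDerivWithinAt G (fderiv ℝ G p) S p :=
        (hG.differentiable (by simp)).differentiableAt.hasFDerivAt.hasFDerivWithinAt
      have h0 : HasFDerivWithinAt G (0 : E3 →L[ℝ] ℝ) S p := by
        refine (hasFDerivWithinAt_const (0 : ℝ) p S).congr_of_eventuallyEq ?_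
          (hS.self_of_nhds.1 hp)
        filter_upwards [mem_nhdsWithin_of_mem_nhds hS, self_mem_nhdsWithin] with x hx hxS
        exact hx.1 hxS
      exact hd.unique_on h0 hu
    exact hle hw
  · intro hw
    obtain ⟨ρ, ρ', -, hρp, hρS, -, hρ', hker⟩ :=
      IsSmoothSurface.exists_retraction hp hG hG' hS
    refine Submodule.subset_span ?_
    have hw' : w ∈ tangentConeAt ℝ {x | ρ x ∈ S} p := by
      rw [tangentConeAt_of_mem_nhds hρS]; trivial
    have h1 := (hρ'.hasFDerivWithinAt (s := {x | ρ x ∈ S})).mapsTo_tangent_cone hw'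
    rw [hker w hw, hρp] at h1
    exact tangentConeAt_mono (by rintro _ ⟨x, hx, rfl⟩; exact hx) h1

lemma tangentialDeriv_eq {S : Set E3} {p : E3} {j : Fin 3} {f : E3 → ℂ} {L : E3 →L[ℝ] ℂ}
    (hL : HasFDerivWithinAt f L S p) :
    tangentialDeriv S j f p =
      L ((tangentPlane S p).starProjection (EuclideanSpace.single j (1 : ℝ))) := by
  have h1 := hL.differentiableWithinAt.hasFDerivWithinAt
  have hle : tangentPlane S p ≤
      LinearMap.ker ((fderivWithin ℝ f S p - L : E3 →L[ℝ] ℂ) : E3 →ₗ[ℝ] ℂ) := by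
    rw [tangentPlane, Submodule.span_le]
    intro u hu
    have := h1.unique_on hL hu
    simpa [sub_eq_zero] using this
  have := hle (Submodule.starProjection_apply_mem (tangentPlane S p)
    (EuclideanSpace.single j (1 : ℝ)))
  simpa [tangentialDeriv, sub_eq_zero] using this

lemma starProjection_tangentPlane {S : Set E3} {p : E3} {G : E3 → ℝ} (hp : p ∈ S)
    (hG : ContDiff ℝ ∞ G) (hG' : fderiv ℝ G p ≠ 0) (hS : ∀ᶠ x in 𝓝 p, (x ∈ S ↔ G x = 0)) (u : E3) :
    (tangentPlane S p).starProjection u =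
      u - (fderiv ℝ G p u / fderiv ℝ G p (coordGradient G p)) • coordGradient G p := by
  have hne := fderiv_coordGradient_ne_zero hG'
  apply Submodule.eq_starProjection_of_mem_of_inner_eq_zero
  · rw [mem_tangentPlane_iff hp hG hG' hS]
    simp [hne]
  · intro w hw
    rw [mem_tangentPlane_iff hp hG hG' hS] at hw
    rw [sub_sub_cancel, inner_smul_left, inner_coordGradient, hw, mul_zero]

/-- `f` agrees on `S` near `p` with a function on `ℝ³` that is `C^n` at `p`. -/
def ExtendsSmoothlyAt (n : WithTop ℕ∞) (S : Set E3) (f : E3 → ℂ) (p : E3) : Prop :=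
  ∃ f' : E3 → ℂ, ContDiffAt ℝ n f' p ∧ f =ᶠ[𝓝[S] p] f'

lemma ContDiffOn.extendsSmoothlyAt {S : Set E3} (hS : IsSmoothSurface S) {f : E3 → ℂ}
    (hf : ContDiffOn ℝ ∞ f S) {p : E3} (hp : p ∈ S) : ExtendsSmoothlyAt ∞ S f p := by
  obtain ⟨G, hG, hG', hSG⟩ := hS p hp
  obtain ⟨ρ, ρ', hρ, hρp, hρS, hρid, -, -⟩ := IsSmoothSurface.exists_retraction hp hG hG' hSG
  refine ⟨f ∘ ρ, ?_, ?_⟩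
  · have h1 : ContDiffWithinAt ℝ ∞ f S (ρ p) := by rw [hρp]; exact hf p hp
    have h2 := h1.comp p (hρ.contDiffWithinAt (s := {x | ρ x ∈ S})) (fun x hx => hx)
    exact h2.contDiffAt hρS
  · filter_upwards [mem_nhdsWithin_of_mem_nhds hρid, self_mem_nhdsWithin] with x hx hxS
    rw [Function.comp_apply, hx hxS]

lemma ExtendsSmoothlyAt.differentiableWithinAt {n : WithTop ℕ∞} {S : Set E3} {f : E3 → ℂ} {p : E3}
    (h : ExtendsSmoothlyAt n S f p) (hn : n ≠ 0) (hp : p ∈ S) : DifferentiableWithinAt ℝ f S p := by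
  obtain ⟨f', hf', he⟩ := h
  exact (hf'.differentiableAt hn).differentiableWithinAt.congr_of_eventuallyEq he
    (he.self_of_nhdsWithin hp)

lemma ExtendsSmoothlyAt.continuousWithinAt {n : WithTop ℕ∞} {S : Set E3} {f : E3 → ℂ} {p : E3}
    (h : ExtendsSmoothlyAt n S f p) (hp : p ∈ S) : ContinuousWithinAt f S p := by
  obtain ⟨f', hf', he⟩ := h
  exact hf'.continuousAt.continuousWithinAt.congr_of_eventuallyEq he (he.self_of_nhdsWithin hp)

lemma ExtendsSmoothlyAt.tangentialDeriv {n : ℕ} {S : Set E3} (hS : IsSmoothSurface S)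
    {f : E3 → ℂ} {p : E3} (hp : p ∈ S) (h : ExtendsSmoothlyAt (n + 1 : ℕ) S f p) (j : Fin 3) :
    ExtendsSmoothlyAt n S (tangentialDeriv S j f) p := by
  obtain ⟨G, hG, hG', hSG⟩ := hS p hp
  obtain ⟨f', hf', he⟩ := h
  have hdG : ContDiff ℝ ∞ (fderiv ℝ G) := hG.fderiv_right (by simp)
  have hgrad : ContDiff ℝ ∞ (coordGradient G) := by
    unfold coordGradient
    exact ContDiff.sum fun i _ => (hdG.clm_apply contDiff_const).smul contDiff_const
  have hne := fderiv_coordGradient_ne_zero hG'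
  refine ⟨fun x => fderiv ℝ f' x (EuclideanSpace.single j 1 -
    (fderiv ℝ G x (EuclideanSpace.single j 1) / fderiv ℝ G x (coordGradient G x)) •
      coordGradient G x), ?_, ?_⟩
  · have h1 : ContDiffAt ℝ n (fderiv ℝ f') p := hf'.fderiv_right (by norm_cast)
    have hle : ((n : ℕ) : WithTop ℕ∞) ≤ ∞ := by exact_mod_cast le_top
    have h2 : ContDiffAt ℝ n (fderiv ℝ G) p := (hdG.of_le hle).contDiffAt
    have h3 : ContDiffAt ℝ n (coordGradient G) p := (hgrad.of_le hle).contDiffAt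
    exact h1.clm_apply (contDiffAt_const.sub
      (((h2.clm_apply contDiffAt_const).div (h2.clm_apply h3) hne).smul h3))
  · have hfd : ∀ᶠ x in 𝓝 p, DifferentiableAt ℝ f' x := by
      have : ContDiffAt ℝ 1 f' p := hf'.of_le (by norm_cast; omega)
      exact (this.eventually (by simp)).mono fun x hx => hx.differentiableAt (by simp)
    have hGd : ∀ᶠ x in 𝓝 p, fderiv ℝ G x ≠ 0 := hdG.continuous.continuousAt.eventually_ne hG'
    have he' : ∀ᶠ x in 𝓝 p, x ∈ S → f =ᶠ[𝓝[S] x] f' := by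
      have := eventually_eventually_nhdsWithin.2 he
      exact eventually_nhdsWithin_iff.1 this
    filter_upwards [mem_nhdsWithin_of_mem_nhds hfd, mem_nhdsWithin_of_mem_nhds hGd,
      mem_nhdsWithin_of_mem_nhds he', mem_nhdsWithin_of_mem_nhds hSG.eventually_nhds,
      self_mem_nhdsWithin] with x h1 h2 h3 h4 hxS
    have h5 : HasFDerivWithinAt f (fderiv ℝ f' x) S x :=
      h1.hasFDerivAt.hasFDerivWithinAt.congr_of_eventuallyEq (h3 hxS)
        ((h3 hxS).self_of_nhdsWithin hxS)
    rw [tangentialDeriv_eq h5, starProjection_tangentPlane hxS hG h2 h4]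

lemma ExtendsSmoothlyAt.of_le {m n : WithTop ℕ∞} {S : Set E3} {f : E3 → ℂ} {p : E3}
    (h : ExtendsSmoothlyAt n S f p) (hmn : m ≤ n) : ExtendsSmoothlyAt m S f p :=
  h.imp fun _ hf => ⟨hf.1.of_le hmn, hf.2⟩

/-- The Laplace-Beltrami operator of a smooth function is continuous, also at the points where the
cylindrical coordinates degenerate. -/
lemma continuousOn_laplaceBeltrami {S : Set E3} (hS : IsSmoothSurface S) {f : E3 → ℂ}
    (hf : ContDiffOn ℝ ∞ f S) : ContinuousOn (laplaceBeltrami S f) S := by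
  refine continuousOn_finsetSum _ fun j _ p hp => ?_
  have h2 : ExtendsSmoothlyAt (2 : ℕ) S f p :=
    (hf.extendsSmoothlyAt hS hp).of_le (WithTop.coe_le_coe.2 le_top)
  exact ((h2.tangentialDeriv hS hp j).tangentialDeriv (n := 0) hS hp j).continuousWithinAt hp

/-! ### The Laplace-Beltrami operator in cylindrical coordinates -/

lemma HasFDerivWithinAt.hasDerivAt_comp_curve {S : Set E3} {h : E3 → ℂ} {L : E3 →L[ℝ] ℂ}
    {c : ℝ → E3} {v : E3} {t : ℝ} (hL : HasFDerivWithinAt h L S (c t)) (hc : HasDerivAt c v t)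
    (hcS : ∀ᶠ τ in 𝓝 t, c τ ∈ S) : HasDerivAt (fun τ => h (c τ)) (L v) t := by
  have := hL.comp_hasDerivWithinAt t (hc.hasDerivWithinAt (s := {τ | c τ ∈ S})) (fun τ hτ => hτ)
  exact this.hasDerivAt hcS

lemma mem_tangentPlane_of_curve {S : Set E3} {c : ℝ → E3} {v : E3} {t : ℝ}
    (hc : HasDerivAt c v t) (hcS : ∀ᶠ τ in 𝓝 t, c τ ∈ S) : v ∈ tangentPlane S (c t) := by
  have h1 : (1 : ℝ) ∈ tangentConeAt ℝ {τ | c τ ∈ S} t := by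
    rw [tangentConeAt_of_mem_nhds hcS]; trivial
  have h2 := (hc.hasFDerivAt.hasFDerivWithinAt (s := {τ | c τ ∈ S})).mapsTo_tangent_cone h1
  have h3 : v ∈ tangentConeAt ℝ (c '' {τ | c τ ∈ S}) (c t) := by simpa using h2
  exact Submodule.subset_span (tangentConeAt_mono (by rintro _ ⟨x, hx, rfl⟩; exact hx) h3)

/-- The coordinate vector `∂/∂z` for a profile with slope `r'`. -/
def tangentZ (r' θ : ℝ) : E3 := !₂[r' * Real.cos θ, r' * Real.sin θ, 1]

/-- The coordinate vector `∂/∂θ` on a circle of radius `ρ`. -/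
def tangentTheta (ρ θ : ℝ) : E3 := !₂[-(ρ * Real.sin θ), ρ * Real.cos θ, 0]

lemma hasDerivAt_toLp {c : ℝ → Fin 3 → ℝ} {v : Fin 3 → ℝ} {t : ℝ}
    (h : ∀ j, HasDerivAt (fun τ => c τ j) (v j) t) :
    HasDerivAt (fun τ => (WithLp.toLp 2 (c τ) : E3)) (WithLp.toLp 2 v) t :=
  (PiLp.continuousLinearEquiv 2 ℝ
    (fun _ : Fin 3 => ℝ)).symm.toContinuousLinearMap.hasFDerivAt.comp_hasDerivAt t
      (hasDerivAt_pi.2 h)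

lemma hasDerivAt_cylPoint_z {r : ℝ → ℝ} {r' z : ℝ} (hr : HasDerivAt r r' z) (θ : ℝ) :
    HasDerivAt (fun t => cylPoint (r t) θ t) (tangentZ r' θ) z := by
  refine hasDerivAt_toLp fun j => ?_
  fin_cases j
  · exact hr.mul_const _
  · exact hr.mul_const _
  · exact hasDerivAt_id z

lemma hasDerivAt_cylPoint_theta (ρ z θ : ℝ) :
    HasDerivAt (fun t => cylPoint ρ t z) (tangentTheta ρ θ) θ := by
  refine hasDerivAt_toLp fun j => ?_
  fin_cases j
  · simpa using (Real.hasDerivAt_cos θ).const_mul ρ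
  · exact (Real.hasDerivAt_sin θ).const_mul ρ
  · exact hasDerivAt_const θ z

/-- The projection of `eⱼ` to the plane spanned by the orthogonal vectors `∂/∂z` and `∂/∂θ`. -/
lemma starProjection_single_of_tangent {K : Submodule ℝ E3} {n : E3} {ρ r' θ : ℝ} (hρ : 0 < ρ)
    (hn : n ≠ 0) (hK : ∀ w ∈ K, inner ℝ n w = 0) (tz : tangentZ r' θ ∈ K)
    (tt : tangentTheta ρ θ ∈ K) (j : Fin 3) :
    K.starProjection (EuclideanSpace.single j (1 : ℝ)) =
      (tangentZ r' θ j / (1 + r' ^ 2)) • tangentZ r' θ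
        + (tangentTheta ρ θ j / ρ ^ 2) • tangentTheta ρ θ := by
  apply Submodule.eq_starProjection_of_mem_of_inner_eq_zero
  · exact Submodule.add_mem _ (Submodule.smul_mem _ _ tz) (Submodule.smul_mem _ _ tt)
  intro w hw
  have nz := hK _ tz
  have nt := hK _ tt
  have nw := hK _ hw
  simp only [tangentZ, tangentTheta, PiLp.inner_apply, Fin.sum_univ_three, RCLike.inner_apply,
    conj_trivial] at nz nt nw
  simp only [Matrix.cons_val] at nz nt
  have hcs := Real.cos_sq_add_sin_sq θ
  have hs0 : 1 + r' ^ 2 ≠ 0 := by positivity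
  -- the normal vector is a multiple of `(cos θ, sin θ, -r')`
  obtain ⟨μ, hμ⟩ : ∃ μ, μ = n 0 * Real.cos θ + n 1 * Real.sin θ := ⟨_, rfl⟩
  have e0 : Real.cos θ * n 1 = Real.sin θ * n 0 := by
    have : ρ * (Real.cos θ * n 1 - Real.sin θ * n 0) = 0 := by linarith
    rcases mul_eq_zero.1 this with h0 | h0
    · exact absurd h0 hρ.ne'
    · linarith
  have n0 : n 0 = μ * Real.cos θ := by
    rw [hμ]; linear_combination (-n 0) * hcs - Real.sin θ * e0
  have n1 : n 1 = μ * Real.sin θ := by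
    rw [hμ]; linear_combination (-n 1) * hcs + Real.cos θ * e0
  have n2 : n 2 = -r' * μ := by rw [hμ]; linear_combination nz
  have hμ0 : μ ≠ 0 := by
    intro h0
    apply hn
    ext k
    fin_cases k <;> simp [n0, n1, n2, h0]
  have hw' : Real.cos θ * w 0 + Real.sin θ * w 1 - r' * w 2 = 0 := by
    apply mul_left_cancel₀ hμ0
    rw [n0, n1, n2] at nw
    linarith
  have iz : inner ℝ (tangentZ r' θ) w = (1 + r' ^ 2) * w 2 := by
    simp only [tangentZ, PiLp.inner_apply, Fin.sum_univ_three, RCLike.inner_apply, conj_trivial,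
      Matrix.cons_val]
    linear_combination r' * hw'
  have it : inner ℝ (tangentTheta ρ θ) w = ρ * (Real.cos θ * w 1 - Real.sin θ * w 0) := by
    simp only [tangentTheta, PiLp.inner_apply, Fin.sum_univ_three, RCLike.inner_apply, conj_trivial,
      Matrix.cons_val]
    ring
  rw [inner_sub_left, inner_add_left, inner_smul_left, inner_smul_left, iz, it,
    EuclideanSpace.inner_single_left]
  simp only [conj_trivial, one_mul]
  have hz : tangentZ r' θ j / (1 + r' ^ 2) * ((1 + r' ^ 2) * w 2) = tangentZ r' θ j * w 2 := by
    field_simp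
  have ht : tangentTheta ρ θ j / ρ ^ 2 * (ρ * (Real.cos θ * w 1 - Real.sin θ * w 0)) =
      tangentTheta ρ θ j / ρ * (Real.cos θ * w 1 - Real.sin θ * w 0) := by
    field_simp
  rw [hz, ht]
  fin_cases j
  · have h1 : tangentZ r' θ 0 = r' * Real.cos θ := rfl
    have h2 : tangentTheta ρ θ 0 / ρ = -Real.sin θ := by
      change -(ρ * Real.sin θ) / ρ = _
      field_simp
    simp only [Fin.zero_eta, h1, h2]
    linear_combination Real.cos θ * hw' - w 0 * hcs
  · have h1 : tangentZ r' θ 1 = r' * Real.sin θ := rfl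
    have h2 : tangentTheta ρ θ 1 / ρ = Real.cos θ := by
      change (ρ * Real.cos θ) / ρ = _
      field_simp
    simp only [Fin.mk_one, h1, h2]
    linear_combination Real.sin θ * hw' - w 1 * hcs
  · have h1 : tangentZ r' θ 2 = 1 := rfl
    have h2 : tangentTheta ρ θ 2 = 0 := rfl
    simp [h1, h2]

namespace AxialSurface

variable {q : ℕ} (M : AxialSurface q)

lemma cylPoint_mem_carrier (i : Fin q) {z : ℝ} (hz : z ∈ Icc M.a M.b) (θ : ℝ) :
    cylPoint (M.r i z) θ z ∈ M.carrier := ⟨i, z, hz, θ, rfl⟩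

lemma contDiffAt_r (i : Fin q) {z : ℝ} (hz : z ∈ Ioo M.a M.b) : ContDiffAt ℝ ∞ (M.r i) z :=
  (M.contDiffOn_r i).contDiffAt (isOpen_Ioo.mem_nhds hz)

lemma hasDerivAt_r (i : Fin q) {z : ℝ} (hz : z ∈ Ioo M.a M.b) :
    HasDerivAt (M.r i) (deriv (M.r i) z) z :=
  ((M.contDiffAt_r i hz).differentiableAt (by simp)).hasDerivAt

lemma contDiffAt_deriv_r (i : Fin q) {z : ℝ} (hz : z ∈ Ioo M.a M.b) :
    ContDiffAt ℝ ∞ (deriv (M.r i)) z :=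
  (((contDiffOn_infty_iff_deriv_of_isOpen isOpen_Ioo).1 (M.contDiffOn_r i)).2).contDiffAt
    (isOpen_Ioo.mem_nhds hz)

/-- On the interior of a sheet the tangential derivatives are
`Dⱼ h = g^{zz} ∂_z xⱼ ∂_z h + g^{θθ} ∂_θ xⱼ ∂_θ h`. -/
lemma tangentialDeriv_cylPoint (i : Fin q) {z : ℝ} (hz : z ∈ Ioo M.a M.b) (θ : ℝ) {h : E3 → ℂ}
    (hd : DifferentiableWithinAt ℝ h M.carrier (cylPoint (M.r i z) θ z)) {hz' ht' : ℂ}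
    (h1 : HasDerivAt (fun t => h (cylPoint (M.r i t) θ t)) hz' z)
    (h2 : HasDerivAt (fun t => h (cylPoint (M.r i z) t z)) ht' θ) (j : Fin 3) :
    tangentialDeriv M.carrier j h (cylPoint (M.r i z) θ z) =
      (tangentZ (deriv (M.r i) z) θ j / (1 + deriv (M.r i) z ^ 2)) • hz'
        + (tangentTheta (M.r i z) θ j / M.r i z ^ 2) • ht' := by
  let S := M.carrier
  let p := cylPoint (M.r i z) θ z
  let r' := deriv (M.r i) z
  have hpS : p ∈ S := M.cylPoint_mem_carrier i (Ioo_subset_Icc_self hz) θ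
  have cz := hasDerivAt_cylPoint_z (M.hasDerivAt_r i hz) θ
  have ct := hasDerivAt_cylPoint_theta (M.r i z) z θ
  have mz : ∀ᶠ t in 𝓝 z, cylPoint (M.r i t) θ t ∈ S := by
    filter_upwards [isOpen_Ioo.mem_nhds hz] with t ht
    exact M.cylPoint_mem_carrier i (Ioo_subset_Icc_self ht) θ
  have mt : ∀ᶠ t in 𝓝 θ, cylPoint (M.r i z) t z ∈ S :=
    Eventually.of_forall fun t => M.cylPoint_mem_carrier i (Ioo_subset_Icc_self hz) t
  have hL := hd.hasFDerivWithinAt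
  have ez : fderivWithin ℝ h S p (tangentZ r' θ) = hz' :=
    (HasFDerivWithinAt.hasDerivAt_comp_curve (c := fun t => cylPoint (M.r i t) θ t) hL cz
      mz).unique h1
  have et : fderivWithin ℝ h S p (tangentTheta (M.r i z) θ) = ht' :=
    (HasFDerivWithinAt.hasDerivAt_comp_curve (c := fun t => cylPoint (M.r i z) t z) hL ct
      mt).unique h2
  have tz : tangentZ r' θ ∈ tangentPlane S p :=
    mem_tangentPlane_of_curve (c := fun t => cylPoint (M.r i t) θ t) cz mz
  have tt : tangentTheta (M.r i z) θ ∈ tangentPlane S p :=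
    mem_tangentPlane_of_curve (c := fun t => cylPoint (M.r i z) t z) ct mt
  obtain ⟨G, hG, hG', hSG⟩ := M.isSmoothSurface p hpS
  have hproj := starProjection_single_of_tangent (M.r_pos i z hz)
    (coordGradient_ne_zero hG') (fun w hw => by
    rw [inner_coordGradient]
    exact (mem_tangentPlane_iff hpS hG hG' hSG).1 hw) tz tt j
  rw [tangentialDeriv, hproj, map_add, map_smul, map_smul, ez, et]

/-- The cylindrical coordinate domain. -/
def coordDomain : Set (ℝ × ℝ) := Ioo M.a M.b ×ˢ univ

lemma isOpen_coordDomain : IsOpen M.coordDomain := isOpen_Ioo.prod isOpen_univ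

/-- A function on the `i`-th sheet in the coordinates `(z, θ)`. -/
def inCoords (i : Fin q) (f : E3 → ℂ) (x : ℝ × ℝ) : ℂ := f (cylPoint (M.r i x.1) x.2 x.1)

lemma contDiffOn_inCoords (i : Fin q) {f : E3 → ℂ} (hf : ContDiffOn ℝ ∞ f M.carrier) :
    ContDiffOn ℝ ∞ (M.inCoords i f) M.coordDomain := by
  have hr : ContDiffOn ℝ ∞ (fun x : ℝ × ℝ => M.r i x.1) M.coordDomain :=
    (M.contDiffOn_r i).comp contDiffOn_fst fun x hx => hx.1
  have hφ : ContDiffOn ℝ ∞ (fun x : ℝ × ℝ => cylPoint (M.r i x.1) x.2 x.1) M.coordDomain := by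
    have : ContDiffOn ℝ ∞ (fun x : ℝ × ℝ =>
        (![M.r i x.1 * Real.cos x.2, M.r i x.1 * Real.sin x.2, x.1] : Fin 3 → ℝ))
        M.coordDomain := by
      rw [contDiffOn_pi]
      intro j
      fin_cases j
      · exact hr.mul (Real.contDiff_cos.comp contDiff_snd).contDiffOn
      · exact hr.mul (Real.contDiff_sin.comp contDiff_snd).contDiffOn
      · exact contDiffOn_fst
    exact (PiLp.continuousLinearEquiv 2 ℝ
      (fun _ : Fin 3 => ℝ)).symm.contDiff.comp_contDiffOn this
  exact hf.comp hφ fun x hx => M.cylPoint_mem_carrier i (Ioo_subset_Icc_self hx.1) x.2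

/-- `∂/∂z` in the coordinates `(z, θ)`. -/
def partialZ (V : ℝ × ℝ → ℂ) (x : ℝ × ℝ) : ℂ := fderiv ℝ V x (1, 0)

/-- `∂/∂θ` in the coordinates `(z, θ)`. -/
def partialTheta (V : ℝ × ℝ → ℂ) (x : ℝ × ℝ) : ℂ := fderiv ℝ V x (0, 1)

variable {M} {V : ℝ × ℝ → ℂ}

lemma contDiffOn_partialZ (hV : ContDiffOn ℝ ∞ V M.coordDomain) :
    ContDiffOn ℝ ∞ (partialZ V) M.coordDomain :=
  (hV.fderiv_of_isOpen M.isOpen_coordDomain (by simp)).clm_apply contDiffOn_const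

lemma contDiffOn_partialTheta (hV : ContDiffOn ℝ ∞ V M.coordDomain) :
    ContDiffOn ℝ ∞ (partialTheta V) M.coordDomain :=
  (hV.fderiv_of_isOpen M.isOpen_coordDomain (by simp)).clm_apply contDiffOn_const

lemma hasFDerivAt_of_coordDomain (hV : ContDiffOn ℝ ∞ V M.coordDomain) {z : ℝ}
    (hz : z ∈ Ioo M.a M.b) (θ : ℝ) : HasFDerivAt V (fderiv ℝ V (z, θ)) (z, θ) :=
  ((hV.contDiffAt (M.isOpen_coordDomain.mem_nhds ⟨hz, trivial⟩)).differentiableAt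
    (by simp)).hasFDerivAt

lemma hasDerivAt_partialZ (hV : ContDiffOn ℝ ∞ V M.coordDomain) {z : ℝ} (hz : z ∈ Ioo M.a M.b)
    (θ : ℝ) : HasDerivAt (fun t => V (t, θ)) (partialZ V (z, θ)) z :=
  (hasFDerivAt_of_coordDomain hV hz θ).comp_hasDerivAt z
    ((hasDerivAt_id z).prodMk (hasDerivAt_const z θ))

lemma hasDerivAt_partialTheta (hV : ContDiffOn ℝ ∞ V M.coordDomain) {z : ℝ}
    (hz : z ∈ Ioo M.a M.b) (θ : ℝ) :
    HasDerivAt (fun t => V (z, t)) (partialTheta V (z, θ)) θ :=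
  (hasFDerivAt_of_coordDomain hV hz θ).comp_hasDerivAt θ
    ((hasDerivAt_const θ z).prodMk (hasDerivAt_id θ))

/-- The Laplace-Beltrami operator in cylindrical coordinates, for the metric
`(1 + r'²) dz² + r² dθ²`. -/
theorem laplaceBeltrami_cylPoint (M : AxialSurface q) (i : Fin q) {f : E3 → ℂ}
    (hf : ContDiffOn ℝ ∞ f M.carrier) {z : ℝ} (hz : z ∈ Ioo M.a M.b) (θ : ℝ) :
    laplaceBeltrami M.carrier f (cylPoint (M.r i z) θ z) =
      (1 + deriv (M.r i) z ^ 2)⁻¹ • partialZ (partialZ (M.inCoords i f)) (z, θ)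
      + (deriv (M.r i) z / (M.r i z * (1 + deriv (M.r i) z ^ 2))
          - deriv (M.r i) z * deriv (deriv (M.r i)) z / (1 + deriv (M.r i) z ^ 2) ^ 2) •
        partialZ (M.inCoords i f) (z, θ)
      + (1 / M.r i z ^ 2) • partialTheta (partialTheta (M.inCoords i f)) (z, θ) := by
  set U := M.inCoords i f with hU
  have hUc : ContDiffOn ℝ ∞ U M.coordDomain := M.contDiffOn_inCoords i hf
  have hZc := contDiffOn_partialZ hUc
  have hTc := contDiffOn_partialTheta hUc
  have hS : IsSmoothSurface M.carrier := M.isSmoothSurface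
  have mem : ∀ t ∈ Ioo M.a M.b, ∀ φ, cylPoint (M.r i t) φ t ∈ M.carrier := fun t ht φ =>
    M.cylPoint_mem_carrier i (Ioo_subset_Icc_self ht) φ
  have c0 : ∀ t ∈ Ioo M.a M.b, ∀ φ (A B : ℂ),
      (tangentZ (deriv (M.r i) t) φ 0 / (1 + deriv (M.r i) t ^ 2)) • A
          + (tangentTheta (M.r i t) φ 0 / M.r i t ^ 2) • B
        = (deriv (M.r i) t / (1 + deriv (M.r i) t ^ 2) * Real.cos φ) • A
          + (1 / M.r i t * -Real.sin φ) • B := by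
    intro t ht φ A B
    have := (M.r_pos i t ht).ne'
    congr 2
    · exact mul_div_right_comm _ _ _
    · change -(M.r i t * Real.sin φ) / M.r i t ^ 2 = _
      field_simp
  have c1 : ∀ t ∈ Ioo M.a M.b, ∀ φ (A B : ℂ),
      (tangentZ (deriv (M.r i) t) φ 1 / (1 + deriv (M.r i) t ^ 2)) • A
          + (tangentTheta (M.r i t) φ 1 / M.r i t ^ 2) • B
        = (deriv (M.r i) t / (1 + deriv (M.r i) t ^ 2) * Real.sin φ) • A
          + (1 / M.r i t * Real.cos φ) • B := by
    intro t ht φ A B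
    have := (M.r_pos i t ht).ne'
    congr 2
    · exact mul_div_right_comm _ _ _
    · change M.r i t * Real.cos φ / M.r i t ^ 2 = _
      field_simp
  have c2 : ∀ t φ (A B : ℂ),
      (tangentZ (deriv (M.r i) t) φ 2 / (1 + deriv (M.r i) t ^ 2)) • A
          + (tangentTheta (M.r i t) φ 2 / M.r i t ^ 2) • B
        = (1 / (1 + deriv (M.r i) t ^ 2)) • A := by
    intro t φ A B
    have h1 : tangentZ (deriv (M.r i) t) φ 2 = 1 := rfl
    have h2 : tangentTheta (M.r i t) φ 2 = 0 := rfl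
    rw [h1, h2, zero_div, zero_smul, add_zero]
  have hD : ∀ j, ∀ t ∈ Ioo M.a M.b, ∀ φ,
      tangentialDeriv M.carrier j f (cylPoint (M.r i t) φ t) =
        (tangentZ (deriv (M.r i) t) φ j / (1 + deriv (M.r i) t ^ 2)) • partialZ U (t, φ)
          + (tangentTheta (M.r i t) φ j / M.r i t ^ 2) • partialTheta U (t, φ) := by
    intro j t ht φ
    exact M.tangentialDeriv_cylPoint i ht φ (hf.differentiableOn (by simp) _ (mem t ht φ))
      (hasDerivAt_partialZ hUc ht φ) (hasDerivAt_partialTheta hUc ht φ) j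
  have hDdiff : ∀ j, DifferentiableWithinAt ℝ (tangentialDeriv M.carrier j f) M.carrier
      (cylPoint (M.r i z) θ z) := by
    intro j
    have h2 : ExtendsSmoothlyAt (2 : ℕ) M.carrier f (cylPoint (M.r i z) θ z) :=
      (hf.extendsSmoothlyAt hS (mem z hz θ)).of_le (WithTop.coe_le_coe.2 le_top)
    exact (h2.tangentialDeriv (n := 1) hS (mem z hz θ) j).differentiableWithinAt (by simp)
      (mem z hz θ)
  have hr0 : M.r i z ≠ 0 := (M.r_pos i z hz).ne'
  set ρ := M.r i z with hρ
  set r₁ := deriv (M.r i) z with hr₁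
  set r₂ := deriv (deriv (M.r i)) z with hr₂
  have hs0 : 1 + r₁ ^ 2 ≠ 0 := by positivity
  have dr : HasDerivAt (M.r i) r₁ z := M.hasDerivAt_r i hz
  have dr' : HasDerivAt (deriv (M.r i)) r₂ z :=
    ((M.contDiffAt_deriv_r i hz).differentiableAt (by simp)).hasDerivAt
  have hs : HasDerivAt (fun t => 1 + deriv (M.r i) t ^ 2) (2 * r₁ * r₂) z := by
    simpa using (dr'.fun_pow 2).const_add 1
  have dA : HasDerivAt (fun t => deriv (M.r i) t / (1 + deriv (M.r i) t ^ 2))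
      (r₂ * (1 - r₁ ^ 2) / (1 + r₁ ^ 2) ^ 2) z := by
    convert! dr'.div hs hs0 using 1
    rw [← hr₁]; ring
  have dT : HasDerivAt (fun t => 1 / (1 + deriv (M.r i) t ^ 2))
      (-(2 * r₁ * r₂) / (1 + r₁ ^ 2) ^ 2) z := by
    simpa using (hasDerivAt_const z (1 : ℝ)).fun_div hs hs0
  have dR : HasDerivAt (fun t => 1 / M.r i t) (-r₁ / ρ ^ 2) z := by
    simpa using (hasDerivAt_const z (1 : ℝ)).fun_div dr hr0
  have zz := hasDerivAt_partialZ hZc hz θ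
  have zt := hasDerivAt_partialTheta hZc hz θ
  have tz := hasDerivAt_partialZ hTc hz θ
  have tt := hasDerivAt_partialTheta hTc hz θ
  have dcos := Real.hasDerivAt_cos θ
  have dsin := Real.hasDerivAt_sin θ
  have hnear : ∀ᶠ t in 𝓝 z, t ∈ Ioo M.a M.b := isOpen_Ioo.mem_nhds hz
  have D0 := M.tangentialDeriv_cylPoint i hz θ (hDdiff 0)
    (((dA.mul_const (Real.cos θ)).smul zz).add ((dR.mul_const (-Real.sin θ)).smul tz)
      |>.congr_of_eventuallyEq (by
        filter_upwards [hnear] with t ht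
        rw [hD 0 t ht θ, c0 t ht]
        rfl))
    (((dcos.const_mul (r₁ / (1 + r₁ ^ 2))).smul zt).add ((dsin.neg.const_mul (1 / ρ)).smul tt)
      |>.congr_of_eventuallyEq (by
        filter_upwards with t
        rw [hD 0 z hz t, c0 z hz]
        rfl)) 0
  have D1 := M.tangentialDeriv_cylPoint i hz θ (hDdiff 1)
    (((dA.mul_const (Real.sin θ)).smul zz).add ((dR.mul_const (Real.cos θ)).smul tz)
      |>.congr_of_eventuallyEq (by
        filter_upwards [hnear] with t ht
        rw [hD 1 t ht θ, c1 t ht]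
        rfl))
    (((dsin.const_mul (r₁ / (1 + r₁ ^ 2))).smul zt).add ((dcos.const_mul (1 / ρ)).smul tt)
      |>.congr_of_eventuallyEq (by
        filter_upwards with t
        rw [hD 1 z hz t, c1 z hz]
        rfl)) 1
  have D2 := M.tangentialDeriv_cylPoint i hz θ (hDdiff 2)
    ((dT.smul zz).congr_of_eventuallyEq (by
        filter_upwards [hnear] with t ht
        rw [hD 2 t ht θ, c2 t]
        rfl))
    ((zt.const_smul (1 / (1 + r₁ ^ 2)))
      |>.congr_of_eventuallyEq (by
        filter_upwards with t
        rw [hD 2 z hz t, c2 z]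
        rfl)) 2
  rw [c0 z hz] at D0
  rw [c1 z hz] at D1
  rw [c2 z] at D2
  rw [laplaceBeltrami, Fin.sum_univ_three, D0, D1, D2, ← hρ, ← hr₁]
  have hcs : (Real.cos θ : ℂ) ^ 2 + (Real.sin θ : ℂ) ^ 2 = 1 := by
    exact_mod_cast Real.cos_sq_add_sin_sq θ
  have hρc : (ρ : ℂ) ≠ 0 := by exact_mod_cast hr0
  have hsc : 1 + (r₁ : ℂ) ^ 2 ≠ 0 := by exact_mod_cast hs0
  generalize partialZ (partialZ U) (z, θ) = Uzz
  generalize partialZ (partialTheta U) (z, θ) = Utz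
  generalize partialTheta (partialZ U) (z, θ) = Uzt
  generalize partialTheta (partialTheta U) (z, θ) = Utt
  generalize partialZ U (z, θ) = Uz
  generalize partialTheta U (z, θ) = Ut
  simp only [Pi.neg_apply, Complex.real_smul, Complex.ofReal_add, Complex.ofReal_mul,
    Complex.ofReal_div, Complex.ofReal_neg, Complex.ofReal_sub, Complex.ofReal_pow,
    Complex.ofReal_one, Complex.ofReal_inv, Complex.ofReal_ofNat]
  generalize (Real.cos θ : ℂ) = C at *
  generalize (Real.sin θ : ℂ) = Sn at *
  obtain ⟨T, hT⟩ : ∃ T : ℂ, T = (1 + (r₁ : ℂ) ^ 2)⁻¹ := ⟨_, rfl⟩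
  obtain ⟨R, hR⟩ : ∃ R : ℂ, R = (ρ : ℂ)⁻¹ := ⟨_, rfl⟩
  have hT' : T * (1 + (r₁ : ℂ) ^ 2) = 1 := by rw [hT, inv_mul_cancel₀ hsc]
  have hT2 : ((1 + (r₁ : ℂ) ^ 2) ^ 2)⁻¹ = T ^ 2 := by rw [hT, inv_pow]
  have hR2 : ((ρ : ℂ) ^ 2)⁻¹ = R ^ 2 := by rw [hR, inv_pow]
  simp only [div_eq_mul_inv, mul_inv, hT2, hR2, ← hT, ← hR, one_mul]
  linear_combination (r₁ * T * (r₂ * (1 - r₁ ^ 2) * T ^ 2 * Uz + r₁ * T * Uzz)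
    + R * (r₁ * T * Uz + R * Utt)) * hcs + (T * Uzz - r₁ * r₂ * T ^ 2 * Uz) * hT'

end AxialSurface

/-! ### Fourier coefficients on circles -/

/-- The Fourier coefficients of a function of the angle. -/
abbrev circleCoeff (g : ℝ → ℂ) (k : ℤ) : ℂ := fourierCoeffOn Real.two_pi_pos g k

lemma circleCoeff_eq_integral (g : ℝ → ℂ) (k : ℤ) :
    circleCoeff g k = (2 * Real.pi : ℝ)⁻¹ •
      ∫ θ in (0 : ℝ)..(2 * Real.pi), Complex.exp (-(Complex.I * k * θ)) * g θ := by
  rw [circleCoeff, fourierCoeffOn_eq_integral, sub_zero, one_div]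
  congr 1
  refine intervalIntegral.integral_congr fun θ _ => ?_
  simp only [fourier_coe_apply, smul_eq_mul]
  congr 2
  have : (Real.pi : ℂ) ≠ 0 := by exact_mod_cast Real.pi_ne_zero
  push_cast
  field_simp

lemma circleCoeff_add {g₁ g₂ : ℝ → ℂ} (h₁ : Continuous g₁) (h₂ : Continuous g₂) (k : ℤ) :
    circleCoeff (fun θ => g₁ θ + g₂ θ) k = circleCoeff g₁ k + circleCoeff g₂ k := by
  have a₁ : Continuous fun θ : ℝ => Complex.exp (-(Complex.I * k * θ)) * g₁ θ := by fun_prop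
  have a₂ : Continuous fun θ : ℝ => Complex.exp (-(Complex.I * k * θ)) * g₂ θ := by fun_prop
  simp only [circleCoeff_eq_integral, mul_add]
  rw [intervalIntegral.integral_add (a₁.intervalIntegrable _ _) (a₂.intervalIntegrable _ _),
    smul_add]

lemma circleCoeff_smul (a : ℝ) (g : ℝ → ℂ) (k : ℤ) :
    circleCoeff (fun θ => a • g θ) k = a • circleCoeff g k := by
  simp only [circleCoeff, Complex.real_smul, fourierCoeffOn.const_mul]

lemma circleCoeff_lincomb {g₁ g₂ g₃ : ℝ → ℂ} (h₁ : Continuous g₁) (h₂ : Continuous g₂)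
    (h₃ : Continuous g₃) (a b c : ℝ) (k : ℤ) :
    circleCoeff (fun θ => a • g₁ θ + b • g₂ θ + c • g₃ θ) k =
      a • circleCoeff g₁ k + b • circleCoeff g₂ k + c • circleCoeff g₃ k := by
  have a₁ : Continuous fun θ => a • g₁ θ := h₁.const_smul a
  have a₂ : Continuous fun θ => b • g₂ θ := h₂.const_smul b
  have a₃ : Continuous fun θ => c • g₃ θ := h₃.const_smul c
  rw [circleCoeff_add (a₁.fun_add a₂) a₃, circleCoeff_add a₁ a₂, circleCoeff_smul, circleCoeff_smul,
    circleCoeff_smul]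

lemma circleCoeff_exp (m k : ℤ) :
    circleCoeff (fun θ => Complex.exp (Complex.I * m * θ)) k = if m = k then 1 else 0 := by
  rw [circleCoeff_eq_integral]
  have hpi : (Real.pi : ℂ) ≠ 0 := by exact_mod_cast Real.pi_ne_zero
  have h1 : ∀ θ : ℝ, Complex.exp (-(Complex.I * k * θ)) * Complex.exp (Complex.I * m * θ) =
      Complex.exp (Complex.I * (m - k : ℤ) * θ) := by
    intro θ
    rw [← Complex.exp_add]
    congr 1
    push_cast
    ring
  simp only [h1]
  split_ifs with h
  · subst h
    simp
    field_simp
  · have hne : Complex.I * (m - k : ℤ) ≠ 0 :=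
      mul_ne_zero Complex.I_ne_zero (by exact_mod_cast sub_ne_zero.2 h)
    rw [integral_exp_mul_complex hne]
    have : Complex.exp (Complex.I * (m - k : ℤ) * (2 * Real.pi : ℝ)) = 1 := by
      rw [← Complex.exp_int_mul_two_pi_mul_I (m - k)]
      congr 1
      push_cast
      ring
    rw [this]
    simp

/-- Integration by parts on the circle. -/
lemma circleCoeff_of_hasDerivAt {g g' : ℝ → ℂ} (hg : ∀ θ, HasDerivAt g (g' θ) θ)
    (hg' : Continuous g') (hp : g (2 * Real.pi) = g 0) (k : ℤ) :
    circleCoeff g' k = Complex.I * k * circleCoeff g k := by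
  have he : Continuous fun θ : ℝ => Complex.exp (-(Complex.I * k * θ)) := by fun_prop
  have hc : Continuous g := continuous_iff_continuousAt.2 fun θ => (hg θ).continuousAt
  have hd : ∀ θ : ℝ, HasDerivAt (fun θ : ℝ => Complex.exp (-(Complex.I * k * θ)) * g θ)
      (Complex.exp (-(Complex.I * k * θ)) * g' θ
        - Complex.I * k * (Complex.exp (-(Complex.I * k * θ)) * g θ)) θ := by
    intro θ
    have h1 : HasDerivAt (fun θ : ℝ => Complex.exp (-(Complex.I * k * θ)))
        (Complex.exp (-(Complex.I * k * θ)) * -(Complex.I * k)) θ := by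
      have h2 : HasDerivAt (fun θ : ℝ => -(Complex.I * k * (θ : ℂ))) (-(Complex.I * k)) θ := by
        simpa using ((Complex.ofRealCLM.hasDerivAt (x := θ)).const_mul (Complex.I * k)).fun_neg
      exact h2.cexp
    convert! h1.mul (hg θ) using 1
    ring
  have c₁ : Continuous fun θ : ℝ => Complex.exp (-(Complex.I * k * θ)) * g' θ := by fun_prop
  have c₂ : Continuous fun θ : ℝ =>
      Complex.I * k * (Complex.exp (-(Complex.I * k * θ)) * g θ) := by fun_prop
  have hint := intervalIntegral.integral_eq_sub_of_hasDerivAt (a := 0) (b := 2 * Real.pi)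
    (fun θ _ => hd θ) ((c₁.sub c₂).intervalIntegrable _ _)
  rw [intervalIntegral.integral_sub (c₁.intervalIntegrable _ _) (c₂.intervalIntegrable _ _),
    intervalIntegral.integral_const_mul] at hint
  have hend : Complex.exp (-(Complex.I * k * (2 * Real.pi : ℝ))) = 1 := by
    rw [← Complex.exp_int_mul_two_pi_mul_I (-k)]
    congr 1
    push_cast
    ring
  rw [hend, hp] at hint
  simp only [Complex.ofReal_zero, mul_zero, neg_zero, Complex.exp_zero, sub_self] at hint
  rw [circleCoeff_eq_integral, circleCoeff_eq_integral, sub_eq_zero.1 hint]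
  simp only [Complex.real_smul]
  ring

/-- A continuous periodic function with vanishing Fourier coefficients vanishes. -/
lemma eq_zero_of_circleCoeff_eq_zero {g : ℝ → ℂ} (hg : Continuous g)
    (hp : Function.Periodic g (2 * Real.pi)) (h : ∀ k, circleCoeff g k = 0) (θ : ℝ) : g θ = 0 := by
  have : Fact (0 < 2 * Real.pi - 0) := ⟨by simpa using Real.two_pi_pos⟩
  have hper : g 0 = g (0 + (2 * Real.pi - 0)) := by
    rw [sub_zero]; exact (hp 0).symm
  have hcont : Continuous (AddCircle.liftIoc (2 * Real.pi - 0) 0 g) :=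
    AddCircle.liftIoc_continuous hper hg.continuousOn
  have h0 : fourierCoeff (⟨_, hcont⟩ : C(AddCircle (2 * Real.pi - 0), ℂ)) = 0 := by
    funext k; exact h k
  have hs := hasSum_fourier_series_of_summable
    (f := (⟨_, hcont⟩ : C(AddCircle (2 * Real.pi - 0), ℂ))) (by rw [h0]; exact summable_zero)
  rw [h0] at hs
  simp only [Pi.zero_apply, zero_smul] at hs
  have hz := hs.unique hasSum_zero
  obtain ⟨y, hy, hgy⟩ := hp.exists_mem_Ioc Real.two_pi_pos θ 0
  rw [hgy, ← AddCircle.liftIoc_coe_apply (p := 2 * Real.pi - 0) (a := 0) (f := g)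
    (by simpa using hy)]
  exact DFunLike.congr_fun hz (y : AddCircle (2 * Real.pi - 0))

namespace AxialSurface

variable {q : ℕ} {M : AxialSurface q} {V : ℝ × ℝ → ℂ}

lemma continuous_slice (hV : ContDiffOn ℝ ∞ V M.coordDomain) {z : ℝ} (hz : z ∈ Ioo M.a M.b) :
    Continuous fun θ => V (z, θ) :=
  continuous_iff_continuousAt.2 fun θ => (hasDerivAt_partialTheta hV hz θ).continuousAt

/-- Differentiation of Fourier coefficients in the height. -/
lemma hasDerivAt_circleCoeff (hV : ContDiffOn ℝ ∞ V M.coordDomain) (k : ℤ) {z : ℝ}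
    (hz : z ∈ Ioo M.a M.b) :
    HasDerivAt (fun t => circleCoeff (fun θ => V (t, θ)) k)
      (circleCoeff (fun θ => partialZ V (z, θ)) k) z := by
  have he : Continuous fun θ : ℝ => Complex.exp (-(Complex.I * k * θ)) := by fun_prop
  obtain ⟨ε, hε, hball⟩ := Metric.nhds_basis_closedBall.mem_iff.1 (isOpen_Ioo.mem_nhds hz)
  have hZc := (contDiffOn_partialZ hV)
  have hcomp : IsCompact (Metric.closedBall z ε ×ˢ Icc (0 : ℝ) (2 * Real.pi)) :=
    (isCompact_closedBall z ε).prod isCompact_Icc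
  obtain ⟨C, hC⟩ := hcomp.exists_bound_of_continuousOn
    (hZc.continuousOn.mono fun x hx => (⟨hball hx.1, trivial⟩ : x ∈ M.coordDomain))
  have hF : ∀ t ∈ Ioo M.a M.b, Continuous fun θ : ℝ =>
      Complex.exp (-(Complex.I * k * θ)) * V (t, θ) := fun t ht => he.mul (continuous_slice hV ht)
  have hF' : Continuous fun θ : ℝ => Complex.exp (-(Complex.I * k * θ)) * partialZ V (z, θ) :=
    he.mul (continuous_slice hZc hz)
  have key := intervalIntegral.hasDerivAt_integral_of_dominated_loc_of_deriv_le
    (μ := MeasureTheory.volume) (a := 0) (b := 2 * Real.pi) (x₀ := z)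
    (F := fun t θ => Complex.exp (-(Complex.I * k * θ)) * V (t, θ))
    (F' := fun t θ => Complex.exp (-(Complex.I * k * θ)) * partialZ V (t, θ))
    (s := Metric.closedBall z ε) (bound := fun _ => C)
    (Metric.closedBall_mem_nhds z hε)
    (by
      filter_upwards [isOpen_Ioo.mem_nhds hz] with t ht
      exact (hF t ht).aestronglyMeasurable)
    ((hF z hz).intervalIntegrable _ _) hF'.aestronglyMeasurable
    (Eventually.of_forall fun θ hθ t ht => by
      rw [uIoc_of_le Real.two_pi_pos.le] at hθ
      have h1 : ‖Complex.exp (-(Complex.I * k * θ))‖ = 1 := by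
        rw [Complex.norm_exp]
        simp
      rw [norm_mul, h1, one_mul]
      exact hC (t, θ) ⟨ht, Ioc_subset_Icc_self hθ⟩)
    intervalIntegrable_const
    (Eventually.of_forall fun θ _ t ht => (hasDerivAt_partialZ hV (hball ht) θ).const_mul _)
  simp only [circleCoeff_eq_integral]
  exact key.2.const_smul ((2 * Real.pi : ℝ)⁻¹)

lemma hasStrictDerivAt_circleCoeff (hV : ContDiffOn ℝ ∞ V M.coordDomain) (k : ℤ) {z : ℝ}
    (hz : z ∈ Ioo M.a M.b) :
    HasStrictDerivAt (fun t => circleCoeff (fun θ => V (t, θ)) k)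
      (circleCoeff (fun θ => partialZ V (z, θ)) k) z := by
  refine hasStrictDerivAt_of_hasDerivAt_of_continuousAt
    (f' := fun t => circleCoeff (fun θ => partialZ V (t, θ)) k) ?_
    (hasDerivAt_circleCoeff (contDiffOn_partialZ hV) k hz).continuousAt
  filter_upwards [isOpen_Ioo.mem_nhds hz] with t ht
  exact hasDerivAt_circleCoeff hV k ht

lemma circleCoeff_partialTheta (hV : ContDiffOn ℝ ∞ V M.coordDomain) {z : ℝ}
    (hz : z ∈ Ioo M.a M.b) (hp : Function.Periodic (fun θ => V (z, θ)) (2 * Real.pi)) (k : ℤ) :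
    circleCoeff (fun θ => partialTheta V (z, θ)) k =
      Complex.I * k * circleCoeff (fun θ => V (z, θ)) k :=
  circleCoeff_of_hasDerivAt (fun θ => hasDerivAt_partialTheta hV hz θ)
    (continuous_slice (contDiffOn_partialTheta hV) hz) (by simpa using hp 0) k

lemma periodic_partialTheta (hV : ContDiffOn ℝ ∞ V M.coordDomain) {z : ℝ}
    (hz : z ∈ Ioo M.a M.b) (hp : Function.Periodic (fun θ => V (z, θ)) (2 * Real.pi)) :
    Function.Periodic (fun θ => partialTheta V (z, θ)) (2 * Real.pi) := by
  intro θ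
  have h1 := (hasDerivAt_partialTheta hV hz (θ + 2 * Real.pi)).comp_add_const θ (2 * Real.pi)
  have h2 : (fun t => V (z, t + 2 * Real.pi)) = fun t => V (z, t) := funext hp
  rw [h2] at h1
  exact h1.unique (hasDerivAt_partialTheta hV hz θ)

lemma cylPoint_periodic (ρ z : ℝ) : Function.Periodic (fun θ => cylPoint ρ θ z) (2 * Real.pi) := by
  intro θ
  simp [cylPoint]

/-- The Laplace-Beltrami operator on the `k`-th Fourier mode. -/
theorem coeff_laplaceBeltrami (M : AxialSurface q) (i : Fin q) {f : E3 → ℂ}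
    (hf : ContDiffOn ℝ ∞ f M.carrier) (k : ℤ) {z : ℝ} (hz : z ∈ Ioo M.a M.b) :
    M.coeff (laplaceBeltrami M.carrier f) i k z =
      (1 + deriv (M.r i) z ^ 2)⁻¹ •
          circleCoeff (fun θ => partialZ (partialZ (M.inCoords i f)) (z, θ)) k
      + (deriv (M.r i) z / (M.r i z * (1 + deriv (M.r i) z ^ 2))
          - deriv (M.r i) z * deriv (deriv (M.r i)) z / (1 + deriv (M.r i) z ^ 2) ^ 2) •
        circleCoeff (fun θ => partialZ (M.inCoords i f) (z, θ)) k
      - ((k : ℝ) ^ 2 / M.r i z ^ 2) • M.coeff f i k z := by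
  have hU := M.contDiffOn_inCoords i hf
  have hZ := contDiffOn_partialZ hU
  have hT := contDiffOn_partialTheta hU
  have hp : Function.Periodic (fun θ => M.inCoords i f (z, θ)) (2 * Real.pi) := by
    intro θ
    simp only [inCoords]
    exact congrArg f (cylPoint_periodic (M.r i z) z θ)
  have e1 : M.coeff (laplaceBeltrami M.carrier f) i k z =
      circleCoeff (fun θ => laplaceBeltrami M.carrier f (cylPoint (M.r i z) θ z)) k := rfl
  have e2 : M.coeff f i k z = circleCoeff (fun θ => M.inCoords i f (z, θ)) k := rfl
  rw [e1, e2]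
  simp only [M.laplaceBeltrami_cylPoint i hf hz]
  have cZZ := continuous_slice (contDiffOn_partialZ hZ) hz
  have cZ := continuous_slice hZ hz
  have cTT := continuous_slice (contDiffOn_partialTheta hT) hz
  rw [circleCoeff_lincomb cZZ cZ cTT,
    circleCoeff_partialTheta hT hz (periodic_partialTheta hU hz hp),
    circleCoeff_partialTheta hU hz hp, sub_eq_add_neg]
  simp only [Complex.real_smul]
  push_cast
  linear_combination (1 / (M.r i z : ℂ) ^ 2 * k ^ 2
    * circleCoeff (fun θ => M.inCoords i f (z, θ)) k) * Complex.I_mul_I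

end AxialSurface

/-! ### The quantized coordinates as weighted shifts -/

namespace AxialSurface

variable {q : ℕ} (M : AxialSurface q) (β : ℝ) (N : ℕ)

/-- The weights of the shift `T_N(x₁ + i x₂)`, extended by zero at both ends. -/
def weight (i : Fin q) (s : ℕ) : ℝ :=
  if 0 < s ∧ s < N then M.r i (M.height β N (s + 1) s) else 0

/-- The quantization of `x₁ + i x₂`, a weighted shift on each sheet. -/
def shiftMatrix : Matrix (Fin q × Fin N) (Fin q × Fin N) ℂ :=
  Matrix.of fun u v => if u.1 = v.1 ∧ (u.2 : ℕ) = v.2 + 1 then (M.weight β N u.1 u.2 : ℂ) else 0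

variable {M β N}

lemma height_comm (n m : ℕ) : M.height β N n m = M.height β N m n := by
  rw [height, height, add_comm (n : ℝ)]

lemma coeff_zero_coord (i : Fin q) (k : ℤ) (z : ℝ) :
    M.coeff (fun p => ((p 0 : ℝ) : ℂ)) i k z =
      1 / 2 * ((if k = 1 then (M.r i z : ℂ) else 0)
        + if k = -1 then (M.r i z : ℂ) else 0) := by
  have h : M.coeff (fun p => ((p 0 : ℝ) : ℂ)) i k z = circleCoeff (fun θ : ℝ =>
      (M.r i z / 2) • Complex.exp (Complex.I * (1 : ℤ) * θ)
        + (M.r i z / 2) • Complex.exp (Complex.I * (-1 : ℤ) * θ)) k := by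
    rw [coeff, circleCoeff]
    congr 1
    funext θ
    have : (cylPoint (M.r i z) θ z) 0 = M.r i z * Real.cos θ := rfl
    rw [this]
    simp only [Complex.real_smul]
    push_cast
    rw [Complex.cos]
    ring_nf
  have c : ∀ m : ℤ, Continuous fun θ : ℝ => (M.r i z / 2) • Complex.exp (Complex.I * m * θ) :=
    fun m => by fun_prop
  rw [h, circleCoeff_add (c 1) (c (-1)), circleCoeff_smul, circleCoeff_smul, circleCoeff_exp,
    circleCoeff_exp]
  by_cases h1 : k = 1
  · subst h1; simp [div_eq_inv_mul]
  · by_cases h2 : k = -1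
    · subst h2; simp [div_eq_inv_mul]
    · simp [h1, h2, Ne.symm h1, Ne.symm h2]

lemma coeff_one_coord (i : Fin q) (k : ℤ) (z : ℝ) :
    M.coeff (fun p => ((p 1 : ℝ) : ℂ)) i k z =
      -(Complex.I / 2) * ((if k = 1 then (M.r i z : ℂ) else 0)
        - if k = -1 then (M.r i z : ℂ) else 0) := by
  have h : M.coeff (fun p => ((p 1 : ℝ) : ℂ)) i k z = circleCoeff (fun θ : ℝ =>
      (-(Complex.I / 2)) * (M.r i z • Complex.exp (Complex.I * (1 : ℤ) * θ)
        + (-M.r i z) • Complex.exp (Complex.I * (-1 : ℤ) * θ))) k := by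
    rw [coeff, circleCoeff]
    congr 1
    funext θ
    have : (cylPoint (M.r i z) θ z) 1 = M.r i z * Real.sin θ := rfl
    rw [this]
    simp only [Complex.real_smul]
    push_cast
    rw [Complex.sin]
    ring_nf
  have c : ∀ (a : ℝ) (m : ℤ), Continuous fun θ : ℝ => a • Complex.exp (Complex.I * m * θ) :=
    fun a m => by fun_prop
  rw [h, circleCoeff, fourierCoeffOn.const_mul]
  change _ * circleCoeff _ k = _
  rw [circleCoeff_add (c _ 1) (c _ (-1)), circleCoeff_smul, circleCoeff_smul, circleCoeff_exp,
    circleCoeff_exp]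
  congr 1
  by_cases h1 : k = 1
  · subst h1; simp
  · by_cases h2 : k = -1
    · subst h2; simp
    · simp [h1, h2, Ne.symm h1, Ne.symm h2]

lemma coeff_two_coord (i : Fin q) (k : ℤ) (z : ℝ) :
    M.coeff (fun p => ((p 2 : ℝ) : ℂ)) i k z = if k = 0 then (z : ℂ) else 0 := by
  have h : M.coeff (fun p => ((p 2 : ℝ) : ℂ)) i k z =
      circleCoeff (fun θ : ℝ => z • Complex.exp (Complex.I * (0 : ℤ) * θ)) k := by
    rw [coeff, circleCoeff]
    congr 1
    funext θ
    have : (cylPoint (M.r i z) θ z) 2 = z := rfl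
    rw [this]
    simp
  rw [h, circleCoeff_smul, circleCoeff_exp]
  by_cases h1 : k = 0
  · subst h1; simp
  · simp [h1, Ne.symm h1]

lemma shiftMatrix_apply (u v : Fin q × Fin N) : M.shiftMatrix β N u v =
    if u.1 = v.1 ∧ (u.2 : ℕ) = v.2 + 1 then
      (M.r u.1 (M.height β N ((u.2 : ℕ) + 1) ((v.2 : ℕ) + 1)) : ℂ) else 0 := by
  rw [shiftMatrix, Matrix.of_apply]
  split_ifs with h
  · rw [weight, if_pos ⟨by omega, u.2.2⟩, ← h.2]
  · rfl

lemma shiftMatrix_conjTranspose_apply (u v : Fin q × Fin N) :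
    (M.shiftMatrix β N).conjTranspose u v =
    if u.1 = v.1 ∧ (v.2 : ℕ) = u.2 + 1 then
      (M.r u.1 (M.height β N ((u.2 : ℕ) + 1) ((v.2 : ℕ) + 1)) : ℂ) else 0 := by
  rw [Matrix.conjTranspose_apply, shiftMatrix_apply]
  by_cases h : u.1 = v.1 ∧ (v.2 : ℕ) = u.2 + 1
  · rw [if_pos h, if_pos ⟨h.1.symm, h.2⟩, height_comm, h.1]
    simp
  · rw [if_neg h, if_neg (fun h' => h ⟨h'.1.symm, h'.2⟩), star_zero]

lemma X_zero : M.X β N 0 =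
    (1 / 2 : ℂ) • (M.shiftMatrix β N + (M.shiftMatrix β N).conjTranspose) := by
  ext u v
  rw [X, quantize, Matrix.of_apply, Matrix.smul_apply, Matrix.add_apply, shiftMatrix_apply,
    shiftMatrix_conjTranspose_apply, coeff_zero_coord]
  by_cases h : u.1 = v.1
  · have e1 : ((u.2 : ℤ) - (v.2 : ℤ) = 1) ↔ (u.2 : ℕ) = v.2 + 1 := by omega
    have e2 : ((u.2 : ℤ) - (v.2 : ℤ) = -1) ↔ (v.2 : ℕ) = u.2 + 1 := by omega
    simp only [h, e1, e2, true_and, if_true, smul_eq_mul]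
  · simp [h]

lemma X_one : M.X β N 1 =
    (-(Complex.I / 2)) • (M.shiftMatrix β N - (M.shiftMatrix β N).conjTranspose) := by
  ext u v
  rw [X, quantize, Matrix.of_apply, Matrix.smul_apply, Matrix.sub_apply, shiftMatrix_apply,
    shiftMatrix_conjTranspose_apply, coeff_one_coord]
  by_cases h : u.1 = v.1
  · have e1 : ((u.2 : ℤ) - (v.2 : ℤ) = 1) ↔ (u.2 : ℕ) = v.2 + 1 := by omega
    have e2 : ((u.2 : ℤ) - (v.2 : ℤ) = -1) ↔ (v.2 : ℕ) = u.2 + 1 := by omega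
    simp only [h, e1, e2, true_and, if_true, smul_eq_mul]
  · simp [h]

lemma X_two : M.X β N 2 =
    Matrix.diagonal fun u => (M.height β N ((u.2 : ℕ) + 1) ((u.2 : ℕ) + 1) : ℂ) := by
  ext u v
  rw [X, quantize, Matrix.of_apply, coeff_two_coord]
  by_cases h : u = v
  · subst h; simp
  · rw [Matrix.diagonal_apply_ne _ h]
    split_ifs with h1 h2
    · exact absurd (Prod.ext h1 (Fin.ext (by omega))) h
    · rfl
    · rfl

/-! ### Products with the shift -/

variable {A : Matrix (Fin q × Fin N) (Fin q × Fin N) ℂ} {i : Fin q} {u v : Fin q × Fin N} {s : ℕ}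

lemma shiftMatrix_mul_apply (h : s + 1 < N) :
    (M.shiftMatrix β N * A) (i, ⟨s + 1, h⟩) v =
      M.weight β N i (s + 1) * A (i, ⟨s, by omega⟩) v := by
  rw [Matrix.mul_apply, Finset.sum_eq_single (i, ⟨s, by omega⟩)]
  · simp [shiftMatrix]
  · rintro ⟨i', t⟩ - hne
    rw [shiftMatrix, Matrix.of_apply, if_neg, zero_mul]
    rintro ⟨h1, h2⟩
    exact hne (Prod.ext h1.symm (Fin.ext (by simpa using h2.symm)))
  · simp

lemma mul_shiftMatrix_apply (h : s + 1 < N) :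
    (A * M.shiftMatrix β N) u (i, ⟨s, by omega⟩) =
      A u (i, ⟨s + 1, h⟩) * M.weight β N i (s + 1) := by
  rw [Matrix.mul_apply, Finset.sum_eq_single (i, ⟨s + 1, h⟩)]
  · simp [shiftMatrix]
  · rintro ⟨i', t⟩ - hne
    rw [shiftMatrix, Matrix.of_apply, if_neg, mul_zero]
    rintro ⟨h1, h2⟩
    exact hne (Prod.ext h1 (Fin.ext (by simpa using h2)))
  · simp

lemma conjTranspose_shiftMatrix_mul_apply (h : s + 1 < N) :
    ((M.shiftMatrix β N).conjTranspose * A) (i, ⟨s, by omega⟩) v =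
      M.weight β N i (s + 1) * A (i, ⟨s + 1, h⟩) v := by
  have := mul_shiftMatrix_apply (M := M) (β := β) (A := A.conjTranspose) (u := v) (i := i) h
  have h2 := congrArg star this
  rw [← Matrix.conjTranspose_apply, Matrix.conjTranspose_mul, Matrix.conjTranspose_conjTranspose]
    at h2
  rw [h2, star_mul', Matrix.conjTranspose_apply, star_star, mul_comm]
  simp

lemma mul_conjTranspose_shiftMatrix_apply (h : s + 1 < N) :
    (A * (M.shiftMatrix β N).conjTranspose) u (i, ⟨s + 1, h⟩) =
      A u (i, ⟨s, by omega⟩) * M.weight β N i (s + 1) := by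
  have := shiftMatrix_mul_apply (M := M) (β := β) (A := A.conjTranspose) (v := u) (i := i) h
  have h2 := congrArg star this
  rw [← Matrix.conjTranspose_apply, Matrix.conjTranspose_mul, Matrix.conjTranspose_conjTranspose]
    at h2
  rw [h2, star_mul', Matrix.conjTranspose_apply, star_star, mul_comm]
  simp

lemma shiftMatrix_mul_conjTranspose :
    M.shiftMatrix β N * (M.shiftMatrix β N).conjTranspose =
      Matrix.diagonal fun u => ((M.weight β N u.1 u.2 ^ 2 : ℝ) : ℂ) := by
  ext ⟨i, s, hs⟩ v
  rcases s with _ | s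
  · rw [Matrix.mul_apply, Finset.sum_eq_zero]
    · simp [Matrix.diagonal_apply, weight]
    · intro x _
      simp [shiftMatrix]
  · rw [shiftMatrix_mul_apply, shiftMatrix_conjTranspose_apply, Matrix.diagonal_apply]
    by_cases h : ((i, ⟨s + 1, hs⟩) : Fin q × Fin N) = v
    · subst h
      rw [if_pos ⟨rfl, rfl⟩, if_pos rfl, weight, if_pos ⟨by omega, hs⟩, height_comm]
      push_cast
      ring
    · rw [if_neg h, if_neg, mul_zero]
      rintro ⟨h1, h2⟩
      exact h (Prod.ext h1 (Fin.ext (by simpa using h2.symm)))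

lemma conjTranspose_mul_shiftMatrix :
    (M.shiftMatrix β N).conjTranspose * M.shiftMatrix β N =
      Matrix.diagonal fun u => ((M.weight β N u.1 (u.2 + 1) ^ 2 : ℝ) : ℂ) := by
  ext ⟨i, s, hs⟩ v
  by_cases hs' : s + 1 < N
  · rw [conjTranspose_shiftMatrix_mul_apply hs', shiftMatrix_apply, Matrix.diagonal_apply]
    by_cases h : ((i, ⟨s, hs⟩) : Fin q × Fin N) = v
    · subst h
      rw [if_pos ⟨rfl, rfl⟩, if_pos rfl, weight, if_pos ⟨by omega, hs'⟩]
      push_cast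
      ring
    · rw [if_neg h, if_neg, mul_zero]
      rintro ⟨h1, h2⟩
      exact h (Prod.ext h1 (Fin.ext (by simpa using h2)))
  · rw [Matrix.mul_apply, Finset.sum_eq_zero]
    · simp [Matrix.diagonal_apply, weight, hs']
    · intro x _
      rw [shiftMatrix_conjTranspose_apply, if_neg, zero_mul]
      rintro ⟨-, h2⟩
      have := x.2.2
      simp at h2
      omega

end AxialSurface

/-! ### The matrix `γ_N` and the noncommutative Laplacian -/

namespace AxialSurface

variable {q : ℕ} {M : AxialSurface q} {β : ℝ} {N : ℕ}

section Commutators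

variable {n : Type*} [Fintype n] (c : ℂ) (A B C : Matrix n n ℂ)

lemma matrix_lie_apply (i j : n) : ⁅A, B⁆ i j = (A * B) i j - (B * A) i j := rfl

lemma matrix_lie_smul : ⁅A, c • B⁆ = c • ⁅A, B⁆ := by
  simp only [Ring.lie_def, mul_smul_comm, smul_mul_assoc, smul_sub]

lemma matrix_smul_lie : ⁅c • A, B⁆ = c • ⁅A, B⁆ := by
  simp only [Ring.lie_def, mul_smul_comm, smul_mul_assoc, smul_sub]

lemma matrix_lie_add : ⁅A, B + C⁆ = ⁅A, B⁆ + ⁅A, C⁆ := by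
  simp only [Ring.lie_def, mul_add, add_mul]
  abel

lemma matrix_add_lie : ⁅A + B, C⁆ = ⁅A, C⁆ + ⁅B, C⁆ := by
  simp only [Ring.lie_def, mul_add, add_mul]
  abel

lemma matrix_lie_sub : ⁅A, B - C⁆ = ⁅A, B⁆ - ⁅A, C⁆ := by
  simp only [Ring.lie_def, mul_sub, sub_mul]
  abel

lemma matrix_sub_lie : ⁅A - B, C⁆ = ⁅A, C⁆ - ⁅B, C⁆ := by
  simp only [Ring.lie_def, mul_sub, sub_mul]
  abel

end Commutators

lemma height_sub_height (n m : ℕ) :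
    M.height β N n n - M.height β N m m = M.hbar β N * ((n : ℝ) - m) := by
  rw [height, height]; ring

lemma lie_X_two_apply (A : Matrix (Fin q × Fin N) (Fin q × Fin N) ℂ) (u v : Fin q × Fin N) :
    ⁅M.X β N 2, A⁆ u v = M.hbar β N * ((u.2 : ℕ) - (v.2 : ℕ) : ℝ) * A u v := by
  rw [Ring.lie_def, Matrix.sub_apply, X_two, Matrix.diagonal_mul, Matrix.mul_diagonal, mul_comm,
    ← mul_sub, ← Complex.ofReal_sub, height_sub_height, mul_comm]
  push_cast
  ring

lemma lie_X_two_shiftMatrix :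
    ⁅M.X β N 2, M.shiftMatrix β N⁆ = (M.hbar β N : ℂ) • M.shiftMatrix β N := by
  ext u v
  rw [lie_X_two_apply, Matrix.smul_apply, smul_eq_mul, shiftMatrix, Matrix.of_apply]
  split_ifs with h
  · rw [h.2]
    push_cast
    ring
  · simp

lemma lie_X_two_conjTranspose :
    ⁅M.X β N 2, (M.shiftMatrix β N).conjTranspose⁆ =
      -((M.hbar β N : ℂ) • (M.shiftMatrix β N).conjTranspose) := by
  ext u v
  rw [lie_X_two_apply, Matrix.neg_apply, Matrix.smul_apply, smul_eq_mul,
    shiftMatrix_conjTranspose_apply]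
  split_ifs with h
  · rw [h.2]
    push_cast
    ring
  · simp

variable (M β N) in
/-- The diagonal entries of `γ_N²`. -/
def gammaSq (u : Fin q × Fin N) : ℝ :=
  (M.weight β N u.1 u.2 ^ 2 + M.weight β N u.1 (u.2 + 1) ^ 2) / 2
    + ((M.weight β N u.1 (u.2 + 1) ^ 2 - M.weight β N u.1 u.2 ^ 2) / (2 * M.hbar β N)) ^ 2

lemma hbar_pos (hβ : 0 < β) (hN : 0 < N) : 0 < M.hbar β N := by
  have := sub_pos.2 M.a_lt_b
  have : (0 : ℝ) < N := by exact_mod_cast hN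
  rw [hbar]; positivity

lemma hbar_mul (hN : 0 < N) : M.hbar β N * N = (M.b - M.a) * β := by
  have : (N : ℝ) ≠ 0 := by exact_mod_cast hN.ne'
  rw [hbar]; field_simp

lemma height_mem_Ioo (hβ : 0 < β) (hβ' : β ≤ 1) {n m : ℕ} (h0 : 0 < n + m) (hN : n + m < 2 * N) :
    M.height β N n m ∈ Ioo M.a M.b := by
  have hN0 : 0 < N := by omega
  have hh := M.hbar_pos hβ hN0
  have hm := M.hbar_mul (β := β) hN0
  have h1 : (0 : ℝ) < n + m := by exact_mod_cast h0
  have h2 : (n + m : ℝ) < 2 * N := by exact_mod_cast hN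
  have h3 : M.hbar β N * ((n + m : ℝ) / 2) < M.hbar β N * N := by
    apply mul_lt_mul_of_pos_left _ hh
    linarith
  have h4 : (M.b - M.a) * β ≤ (M.b - M.a) * 1 :=
    mul_le_mul_of_nonneg_left hβ' (sub_pos.2 M.a_lt_b).le
  have h5 : 0 < M.hbar β N * ((n + m : ℝ) / 2) := by positivity
  rw [height]
  constructor <;> linarith

lemma weight_eq {i : Fin q} {s : ℕ} (hs : 0 < s) (hsN : s < N) :
    M.weight β N i s = M.r i (M.height β N (s + 1) s) := if_pos ⟨hs, hsN⟩

lemma weight_pos (hβ : 0 < β) (hβ' : β ≤ 1) {i : Fin q} {s : ℕ} (hs : 0 < s) (hsN : s < N) :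
    0 < M.weight β N i s := by
  rw [weight_eq hs hsN]
  have := height_mem_Ioo (M := M) (N := N) hβ hβ' (n := s + 1) (m := s) (by omega) (by omega)
  exact M.r_pos i _ this

/-- For `N ≥ 2` every index has a neighbour on the grid, so one of its two weights is positive. -/
lemma gammaSq_pos (hβ : 0 < β) (hβ' : β ≤ 1) (hN : 2 ≤ N) (u : Fin q × Fin N) :
    0 < M.gammaSq β N u := by
  have hu := u.2.2
  have h : 0 < M.weight β N u.1 u.2 ^ 2 + M.weight β N u.1 (u.2 + 1) ^ 2 := by
    by_cases h0 : 0 < (u.2 : ℕ)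
    · have := weight_pos (M := M) (i := u.1) hβ hβ' h0 hu
      positivity
    · have := weight_pos (M := M) (N := N) (i := u.1) hβ hβ' (s := u.2 + 1) (by omega) (by omega)
      positivity
  rw [gammaSq]
  positivity

lemma sum_sq_lie_X (hh : M.hbar β N ≠ 0) :
    (∑ i : Fin 3, ∑ j ∈ Finset.Iio i,
      -((((M.hbar β N : ℝ) : ℂ)⁻¹ • ⁅M.X β N i, M.X β N j⁆) ^ 2)) =
    Matrix.diagonal fun u => (M.gammaSq β N u : ℂ) := by
  have i0 : Finset.Iio (0 : Fin 3) = ∅ := by decide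
  have i1 : Finset.Iio (1 : Fin 3) = {0} := by decide
  have i2 : Finset.Iio (2 : Fin 3) = {0, 1} := by decide
  have hc : (M.hbar β N : ℂ) ≠ 0 := by exact_mod_cast hh
  rw [Fin.sum_univ_three, i0, i1, i2, Finset.sum_empty, Finset.sum_singleton,
    Finset.sum_pair (by decide)]
  have l20 : ((M.hbar β N : ℝ) : ℂ)⁻¹ • ⁅M.X β N 2, M.X β N 0⁆ =
      (1 / 2 : ℂ) • (M.shiftMatrix β N - (M.shiftMatrix β N).conjTranspose) := by
    rw [X_zero, matrix_lie_smul, matrix_lie_add, lie_X_two_shiftMatrix, lie_X_two_conjTranspose,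
      ← sub_eq_add_neg, ← smul_sub, smul_smul, smul_smul]
    congr 1
    field_simp
  have l21 : ((M.hbar β N : ℝ) : ℂ)⁻¹ • ⁅M.X β N 2, M.X β N 1⁆ =
      (-(Complex.I / 2)) • (M.shiftMatrix β N + (M.shiftMatrix β N).conjTranspose) := by
    rw [X_one, matrix_lie_smul, matrix_lie_sub, lie_X_two_shiftMatrix, lie_X_two_conjTranspose,
      sub_neg_eq_add, ← smul_add, smul_smul, smul_smul]
    congr 1
    field_simp
  have l10 : ((M.hbar β N : ℝ) : ℂ)⁻¹ • ⁅M.X β N 1, M.X β N 0⁆ =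
      (-(Complex.I / 2) * (M.hbar β N : ℂ)⁻¹) •
        (M.shiftMatrix β N * (M.shiftMatrix β N).conjTranspose
          - (M.shiftMatrix β N).conjTranspose * M.shiftMatrix β N) := by
    rw [X_zero, X_one, matrix_smul_lie, matrix_lie_smul, Ring.lie_def, smul_smul, smul_smul]
    have : (M.shiftMatrix β N - (M.shiftMatrix β N).conjTranspose) *
        (M.shiftMatrix β N + (M.shiftMatrix β N).conjTranspose) -
        (M.shiftMatrix β N + (M.shiftMatrix β N).conjTranspose) *
        (M.shiftMatrix β N - (M.shiftMatrix β N).conjTranspose) =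
        (2 : ℂ) • (M.shiftMatrix β N * (M.shiftMatrix β N).conjTranspose
          - (M.shiftMatrix β N).conjTranspose * M.shiftMatrix β N) := by
      rw [two_smul]
      noncomm_ring
    rw [this, smul_smul]
    congr 1
    ring
  rw [l20, l21, l10, smul_pow, smul_pow, smul_pow]
  have e : -((1 / 2 : ℂ) ^ 2 • (M.shiftMatrix β N - (M.shiftMatrix β N).conjTranspose) ^ 2) +
      -((-(Complex.I / 2)) ^ 2 • (M.shiftMatrix β N + (M.shiftMatrix β N).conjTranspose) ^ 2) =
      (1 / 2 : ℂ) • (M.shiftMatrix β N * (M.shiftMatrix β N).conjTranspose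
          + (M.shiftMatrix β N).conjTranspose * M.shiftMatrix β N) := by
    have h1 : (-(Complex.I / 2)) ^ 2 = -(1 / 4 : ℂ) := by
      rw [neg_sq, div_pow, Complex.I_sq]; norm_num
    have h2 : (1 / 2 : ℂ) ^ 2 = 1 / 4 := by norm_num
    rw [h1, h2, sq, sq, sub_mul, mul_sub, mul_sub, add_mul, mul_add, mul_add]
    module
  rw [e, shiftMatrix_mul_conjTranspose, conjTranspose_mul_shiftMatrix, Matrix.diagonal_sub,
    Matrix.diagonal_add, Matrix.diagonal_pow, ← Matrix.diagonal_smul, ← Matrix.diagonal_smul,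
    Matrix.diagonal_neg, zero_add, Matrix.diagonal_add]
  congr 1
  funext u
  simp only [gammaSq, Pi.smul_apply, Pi.pow_apply, smul_eq_mul]
  push_cast
  rw [mul_pow, neg_sq, div_pow, Complex.I_sq]
  field_simp
  ring

open scoped ComplexOrder in
lemma gammaMatrix_eq (hh : M.hbar β N ≠ 0) :
    M.gammaMatrix β N = Matrix.diagonal fun u => ((√(M.gammaSq β N u) : ℝ) : ℂ) := by
  have hnn : ∀ u, 0 ≤ M.gammaSq β N u := fun u => by rw [gammaSq]; positivity
  rw [gammaMatrix, sum_sq_lie_X hh]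
  apply CFC.sqrt_unique
  · rw [Matrix.diagonal_mul_diagonal]
    congr 1
    funext u
    rw [← Complex.ofReal_mul, Real.mul_self_sqrt (hnn u)]
  · rw [Matrix.nonneg_iff_posSemidef]
    apply Matrix.PosSemidef.diagonal
    intro u
    exact Complex.zero_le_real.2 (Real.sqrt_nonneg _)

lemma gammaMatrix_inv (hβ : 0 < β) (hβ' : β ≤ 1) (hN : 2 ≤ N) :
    (M.gammaMatrix β N)⁻¹ = Matrix.diagonal fun u => (((√(M.gammaSq β N u))⁻¹ : ℝ) : ℂ) := by
  apply Matrix.inv_eq_left_inv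
  rw [gammaMatrix_eq (M.hbar_pos hβ (by omega)).ne', Matrix.diagonal_mul_diagonal,
    ← Matrix.diagonal_one]
  congr 1
  funext u
  rw [← Complex.ofReal_mul, inv_mul_cancel₀ (Real.sqrt_pos.2 (gammaSq_pos hβ hβ' hN u)).ne',
    Complex.ofReal_one]

/-- The noncommutative Laplacian in terms of the shift `W`, from
`X₁ ⊗ X₁ + X₂ ⊗ X₂ = (W ⊗ W* + W* ⊗ W) / 2`. -/
lemma ncLaplacian_eq_shift (A : Matrix (Fin q × Fin N) (Fin q × Fin N) ℂ) :
    M.ncLaplacian β N A = -((((M.hbar β N : ℝ) : ℂ) ^ 2)⁻¹ •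
      ((M.gammaMatrix β N)⁻¹ * ((1 / 2 : ℂ) •
        (⁅M.shiftMatrix β N, (M.gammaMatrix β N)⁻¹ * ⁅(M.shiftMatrix β N).conjTranspose, A⁆⁆
          + ⁅(M.shiftMatrix β N).conjTranspose, (M.gammaMatrix β N)⁻¹ * ⁅M.shiftMatrix β N, A⁆⁆))
        + (M.gammaMatrix β N)⁻¹ * ⁅M.X β N 2, (M.gammaMatrix β N)⁻¹ * ⁅M.X β N 2, A⁆⁆)) := by
  rw [ncLaplacian, Fin.sum_univ_three, ← mul_add]
  congr 3
  rw [X_zero, X_one]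
  congr 1
  generalize M.shiftMatrix β N = W
  generalize W.conjTranspose = W'
  generalize (M.gammaMatrix β N)⁻¹ = B
  have hI : (-(Complex.I / 2)) * (-(Complex.I / 2)) = -(1 / 4 : ℂ) := by
    linear_combination (1 / 4) * Complex.I_mul_I
  simp only [matrix_smul_lie, mul_smul_comm, matrix_lie_smul, smul_smul]
  rw [hI]
  simp only [matrix_add_lie, matrix_sub_lie, mul_add, mul_sub, matrix_lie_add, matrix_lie_sub]
  module

end AxialSurface

/-! ### Interior entries and their limits -/

namespace AxialSurface

variable {q : ℕ} {M : AxialSurface q} {β : ℝ} {N : ℕ}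

lemma gammaSq_eq_quantizedDensity (i : Fin q) {s : ℕ} (hs : 0 < s) (hsN : s + 1 < N) :
    M.gammaSq β N (i, ⟨s, by omega⟩) =
      quantizedDensity (M.r i) (M.hbar β N) (M.height β N (s + 1) (s + 1)) := by
  have e1 : M.height β N (s + 1) s = M.height β N (s + 1) (s + 1) - M.hbar β N / 2 := by
    simp only [height]; push_cast; ring
  have e2 : M.height β N (s + 1 + 1) (s + 1) = M.height β N (s + 1) (s + 1) + M.hbar β N / 2 := by
    simp only [height]; push_cast; ring
  simp only [gammaSq, quantizedDensity, weight_eq hs (show s < N by omega),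
    weight_eq (Nat.succ_pos s) hsN, e1, e2]

/-- Away from the ends of the grid, the entries of `Δ_N T_N(f)` are given by the discrete symbol. -/
theorem ncLaplacian_quantize_apply (hβ : 0 < β) (hβ' : β ≤ 1) (f : E3 → ℂ) (i : Fin q) {s t : ℕ}
    (hs : 0 < s) (hsN : s + 3 < N) (htN : t + 2 < N) :
    M.ncLaplacian β N (M.quantize β N f) (i, ⟨s + 1, by omega⟩) (i, ⟨t + 1, by omega⟩) =
      discreteSymbol (M.r i) (M.coeff f i ((s : ℤ) - t)) ((s : ℝ) - t) (M.hbar β N)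
        (M.height β N (s + 2) (t + 2)) := by
  have hh : M.hbar β N ≠ 0 := (M.hbar_pos hβ (by omega)).ne'
  have hN : 2 ≤ N := by omega
  set η := M.hbar β N with hη
  set x := M.height β N (s + 2) (t + 2) with hx
  set k : ℝ := (s : ℝ) - t with hk
  set c := M.coeff f i ((s : ℤ) - t) with hc
  set A := M.quantize β N f with hA
  have wr : ∀ (n : ℕ) (α : ℝ), 0 < n → n < N → M.height β N (n + 1) n = x + α * η →
      M.weight β N i n = M.r i (x + α * η) := fun n α h0 h1 h2 => by
    rw [weight_eq h0 h1, h2]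
  have w1 := wr (s + 2) ((k + 1) / 2) (by omega) (by omega)
    (by simp only [hx, hk, height, hη]; push_cast; ring)
  have w2 := wr (s + 1) ((k - 1) / 2) (by omega) (by omega)
    (by simp only [hx, hk, height, hη]; push_cast; ring)
  have w3 := wr (t + 1) (-(k + 1) / 2) (by omega) (by omega)
    (by simp only [hx, hk, height, hη]; push_cast; ring)
  have w4 := wr (t + 2) (-(k - 1) / 2) (by omega) (by omega)
    (by simp only [hx, hk, height, hη]; push_cast; ring)
  have br : ∀ (n : ℕ) (j : ℝ) (h0 : 0 < n) (h1 : n + 1 < N),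
      M.height β N (n + 1) (n + 1) = x + k / 2 * η + j * η →
      M.gammaSq β N (i, ⟨n, by omega⟩) =
        quantizedDensity (M.r i) η (x + k / 2 * η + j * η) := fun n j h0 h1 h2 => by
    rw [gammaSq_eq_quantizedDensity i h0 h1, h2]
  have b0 := br (s + 1) 0 (by omega) (by omega)
    (by simp only [hx, hk, height, hη]; push_cast; ring)
  have b1 := br (s + 2) 1 (by omega) (by omega)
    (by simp only [hx, hk, height, hη]; push_cast; ring)
  have b2 := br s (-1) (by omega) (by omega)
    (by simp only [hx, hk, height, hη]; push_cast; ring)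
  have a0 : A (i, ⟨s + 1, by omega⟩) (i, ⟨t + 1, by omega⟩) = c x := by
    rw [hA, quantize, Matrix.of_apply, if_pos rfl, hc, hx]
    congr 1
    push_cast; ring
  have a1 : A (i, ⟨s + 2, by omega⟩) (i, ⟨t + 2, by omega⟩) = c (x + η) := by
    rw [hA, quantize, Matrix.of_apply, if_pos rfl, hc, hx, hη]
    congr 1
    · push_cast; ring
    · simp only [height]; push_cast; ring
  have a2 : A (i, ⟨s, by omega⟩) (i, ⟨t, by omega⟩) = c (x - η) := by
    rw [hA, quantize, Matrix.of_apply, if_pos rfl, hc, hx, hη]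
    congr 1
    simp only [height]; push_cast; ring
  rw [ncLaplacian_eq_shift, gammaMatrix_inv hβ hβ' hN]
  simp only [Matrix.neg_apply, Matrix.smul_apply, Matrix.add_apply, Matrix.diagonal_mul,
    lie_X_two_apply, smul_eq_mul]
  rw [matrix_lie_apply, matrix_lie_apply,
    shiftMatrix_mul_apply (by omega), mul_shiftMatrix_apply (s := t + 1) (by omega),
    conjTranspose_shiftMatrix_mul_apply (s := s + 1) (by omega),
    mul_conjTranspose_shiftMatrix_apply (by omega)]
  simp only [Matrix.diagonal_mul, matrix_lie_apply]
  rw [conjTranspose_shiftMatrix_mul_apply (s := s) (by omega),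
    mul_conjTranspose_shiftMatrix_apply (s := t) (by omega),
    conjTranspose_shiftMatrix_mul_apply (s := s + 1) (by omega),
    mul_conjTranspose_shiftMatrix_apply (s := t + 1) (by omega),
    shiftMatrix_mul_apply (s := s + 1) (by omega), mul_shiftMatrix_apply (s := t + 1) (by omega),
    shiftMatrix_mul_apply (s := s) (by omega), mul_shiftMatrix_apply (s := t) (by omega)]
  rw [a0, a1, a2, b0, b1, b2, w1, w2, w3, w4]
  simp only [discreteSymbol]
  generalize (√(quantizedDensity (M.r i) η (x + k / 2 * η + 0 * η)))⁻¹ = B₀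
  generalize (√(quantizedDensity (M.r i) η (x + k / 2 * η + 1 * η)))⁻¹ = B₁
  generalize (√(quantizedDensity (M.r i) η (x + k / 2 * η + -1 * η)))⁻¹ = B₂
  generalize M.r i (x + (k + 1) / 2 * η) = w₁
  generalize M.r i (x + (k - 1) / 2 * η) = w₂
  generalize M.r i (x + -(k + 1) / 2 * η) = w₃
  generalize M.r i (x + -(k - 1) / 2 * η) = w₄
  have hk' : ((s + 1 : ℕ) : ℝ) - ((t + 1 : ℕ) : ℝ) = k := by rw [hk]; push_cast; ring
  simp only [hk', ← hη, Complex.real_smul]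
  have : (η : ℂ) ≠ 0 := by exact_mod_cast hh
  push_cast
  field_simp
  ring

lemma tendsto_hbar (M : AxialSurface q) (β : ℝ) :
    Tendsto (fun N => M.hbar β N) atTop (𝓝 0) :=
  tendsto_const_div_atTop_nhds_zero_nat _

/-- On each circle at height `z₀ ∈ (a, a + (b - a) β)` the Fourier coefficients of `Δ_g f` and `λ f`
agree: follow the entries on the `k`-th diagonal along grid points converging to `z₀`. -/
theorem IsEigenmatrixSequence.coeff_laplaceBeltrami_eq (hβ : 0 < β) (hβ' : β ≤ 1)
    {F : (N : ℕ) → Matrix (Fin q × Fin N) (Fin q × Fin N) ℂ} {f : E3 → ℂ} {lam : ℕ → ℂ} {l : ℂ}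
    (h : M.IsEigenmatrixSequence β F f lam l) (i : Fin q) (k : ℤ) {z₀ : ℝ}
    (hz₀ : z₀ ∈ Ioo M.a (M.a + (M.b - M.a) * β)) :
    M.coeff (laplaceBeltrami M.carrier f) i k z₀ = l * M.coeff f i k z₀ := by
  have hab : 0 < M.b - M.a := sub_pos.2 M.a_lt_b
  have hz : z₀ ∈ Ioo M.a M.b := by
    refine ⟨hz₀.1, hz₀.2.trans_le ?_⟩
    have : (M.b - M.a) * β ≤ (M.b - M.a) * 1 := mul_le_mul_of_nonneg_left hβ' hab.le
    linarith
  have hη := M.tendsto_hbar β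
  have hηpos : ∀ᶠ N in atTop, 0 < M.hbar β N := by
    filter_upwards [eventually_gt_atTop 0] with N hN
    exact M.hbar_pos hβ hN
  set y : ℕ → ℕ := fun N => ⌊(z₀ - M.a) / M.hbar β N⌋₊ with hy
  have hc : 0 < z₀ - M.a := sub_pos.2 hz₀.1
  have hyle : ∀ᶠ N in atTop, M.hbar β N * y N ≤ z₀ - M.a := by
    filter_upwards [hηpos] with N hN
    have := Nat.floor_le (div_pos hc hN).le
    rw [le_div_iff₀ hN] at this
    rw [mul_comm]; exact this
  have hylt : ∀ᶠ N in atTop, z₀ - M.a < M.hbar β N * y N + M.hbar β N := by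
    filter_upwards [hηpos] with N hN
    have := Nat.lt_floor_add_one ((z₀ - M.a) / M.hbar β N)
    rw [div_lt_iff₀ hN] at this
    calc z₀ - M.a < _ := this
      _ = _ := by ring
  have hylim : Tendsto (fun N => M.hbar β N * y N) atTop (𝓝 (z₀ - M.a)) := by
    refine tendsto_of_tendsto_of_tendsto_of_le_of_le' (g := fun N => z₀ - M.a - M.hbar β N) ?_
      tendsto_const_nhds ?_ hyle
    · simpa using (tendsto_const_nhds (x := z₀ - M.a)).sub hη
    · filter_upwards [hylt] with N hN
      linarith
  -- the column index `t = y - k` stays away from the ends of the grid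
  set K : ℕ := k.natAbs with hK
  have hlow : ∀ᶠ N in atTop, K + 1 ≤ y N := by
    have h1 : Tendsto (fun N => M.hbar β N * (K + 2 : ℝ)) atTop (𝓝 0) := by
      simpa using hη.mul_const (K + 2 : ℝ)
    filter_upwards [h1.eventually (gt_mem_nhds hc), hηpos, hylt] with N h2 h3 h4
    have h5 : M.hbar β N * (K + 2 : ℝ) < M.hbar β N * (y N + 1) := by linarith
    have h6 : (K + 2 : ℝ) < y N + 1 := lt_of_mul_lt_mul_left h5 h3.le
    have h7 : K + 2 < y N + 1 := by exact_mod_cast h6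
    omega
  have hhigh : ∀ᶠ N in atTop, y N + K + 3 < N := by
    have h1 : Tendsto (fun N => M.hbar β N * (K + 3 : ℝ)) atTop (𝓝 0) := by
      simpa using hη.mul_const (K + 3 : ℝ)
    have hgap : 0 < M.a + (M.b - M.a) * β - z₀ := sub_pos.2 hz₀.2
    filter_upwards [h1.eventually (gt_mem_nhds hgap), hηpos, hyle, eventually_gt_atTop 0]
      with N h2 h3 h4 h5
    have h6 := M.hbar_mul (β := β) h5
    have h7 : M.hbar β N * (y N + K + 3 : ℝ) < M.hbar β N * N := by
      rw [h6]; linarith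
    have h8 : (y N + K + 3 : ℝ) < N := lt_of_mul_lt_mul_left h7 h3.le
    exact_mod_cast h8
  set t : ℕ → ℕ := fun N => ((y N : ℤ) - k).toNat with ht
  have hkt : ∀ᶠ N in atTop, (y N : ℤ) - t N = k := by
    filter_upwards [hlow] with N hN
    simp only [ht]
    omega
  set x : ℕ → ℝ := fun N => M.height β N (y N + 2) (t N + 2) with hx
  have hxlim : Tendsto x atTop (𝓝 z₀) := by
    have h1 := ((hylim.add (hη.mul_const ((4 - k : ℝ) / 2))).const_add M.a)
    rw [zero_mul, add_zero, add_sub_cancel] at h1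
    refine h1.congr' ?_
    filter_upwards [hkt] with N hN
    have h2 : (t N : ℝ) = y N - k := by
      have : (t N : ℤ) = y N - k := by omega
      exact_mod_cast this
    simp only [hx, height]
    push_cast
    rw [h2]
    ring
  have hU := M.contDiffOn_inCoords i h.smooth
  have hlim := tendsto_discreteSymbol (k : ℝ) (M.r_pos i z₀ hz)
    (r := M.r i) (r₁ := deriv (M.r i)) (r₂ := deriv (deriv (M.r i)) z₀)
    (c := M.coeff f i k) (c₁ := fun z => circleCoeff (fun θ => partialZ (M.inCoords i f) (z, θ)) k)
    (by
      filter_upwards [isOpen_Ioo.mem_nhds hz] with z hz'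
      exact M.hasDerivAt_r i hz')
    ((M.contDiffAt_deriv_r i hz).hasStrictDerivAt (by simp))
    (by
      filter_upwards [isOpen_Ioo.mem_nhds hz] with z hz'
      exact hasDerivAt_circleCoeff hU k hz')
    (hasStrictDerivAt_circleCoeff (contDiffOn_partialZ hU) k hz) hxlim hη hηpos
  rw [← M.coeff_laplaceBeltrami i h.smooth k hz] at hlim
  have hcont : Tendsto (fun N => M.coeff f i k (x N)) atTop (𝓝 (M.coeff f i k z₀)) :=
    (hasDerivAt_circleCoeff hU k hz).continuousAt.tendsto.comp hxlim
  refine tendsto_nhds_unique hlim ((h.tendsto.mul hcont).congr' ?_)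
  filter_upwards [hlow, hhigh, hkt, h.eigen] with N h1 h2 h3 h4
  have hs : 0 < y N := by omega
  have hsN : y N + 3 < N := by omega
  have htN : t N + 2 < N := by omega
  have h5 := ncLaplacian_quantize_apply (M := M) hβ hβ' f i hs hsN htN
  have h6 : ((y N : ℝ) - t N) = k := by exact_mod_cast h3
  rw [h.eq_quantize N] at h4
  rw [h4, h3, h6, Matrix.smul_apply, smul_eq_mul, quantize, Matrix.of_apply, if_pos rfl] at h5
  rw [← h5]
  congr 2
  push_cast
  omega

/-- The eigenvalue equation holds on the part of the surface that the grid covers. -/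
theorem IsEigenmatrixSequence.laplaceBeltrami_eq (hβ : 0 < β) (hβ' : β ≤ 1)
    {F : (N : ℕ) → Matrix (Fin q × Fin N) (Fin q × Fin N) ℂ} {f : E3 → ℂ} {lam : ℕ → ℂ} {l : ℂ}
    (h : M.IsEigenmatrixSequence β F f lam l) (i : Fin q) (θ : ℝ) {z : ℝ}
    (hz : z ∈ Icc M.a (M.a + (M.b - M.a) * β)) :
    laplaceBeltrami M.carrier f (cylPoint (M.r i z) θ z) = l * f (cylPoint (M.r i z) θ z) := by
  have hab : 0 < M.b - M.a := sub_pos.2 M.a_lt_b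
  have hle : M.a + (M.b - M.a) * β ≤ M.b := by
    have : (M.b - M.a) * β ≤ (M.b - M.a) * 1 := mul_le_mul_of_nonneg_left hβ' hab.le
    linarith
  have hlt : M.a < M.a + (M.b - M.a) * β := by
    have := mul_pos hab hβ
    linarith
  have hΔ : ContinuousOn (laplaceBeltrami M.carrier f) M.carrier :=
    continuousOn_laplaceBeltrami M.isSmoothSurface h.smooth
  have hf : ContinuousOn f M.carrier := h.smooth.continuousOn
  have hint : ∀ z' ∈ Ioo M.a (M.a + (M.b - M.a) * β),
      laplaceBeltrami M.carrier f (cylPoint (M.r i z') θ z') =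
        l * f (cylPoint (M.r i z') θ z') := by
    intro z' hz'
    have hz'' : z' ∈ Ioo M.a M.b := ⟨hz'.1, hz'.2.trans_le hle⟩
    have hmaps : ∀ φ, cylPoint (M.r i z') φ z' ∈ M.carrier := fun φ =>
      M.cylPoint_mem_carrier i (Ioo_subset_Icc_self hz'') φ
    have hcyl : Continuous fun φ => cylPoint (M.r i z') φ z' :=
      continuous_iff_continuousAt.2 fun φ =>
        (hasDerivAt_cylPoint_theta (M.r i z') z' φ).continuousAt
    have c1 : Continuous fun φ => laplaceBeltrami M.carrier f (cylPoint (M.r i z') φ z') :=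
      hΔ.comp_continuous hcyl hmaps
    have c2 : Continuous fun φ => f (cylPoint (M.r i z') φ z') := hf.comp_continuous hcyl hmaps
    have c3 : Continuous fun φ => -l * f (cylPoint (M.r i z') φ z') := c2.const_mul _
    have := eq_zero_of_circleCoeff_eq_zero
      (g := fun φ => laplaceBeltrami M.carrier f (cylPoint (M.r i z') φ z')
        + -l * f (cylPoint (M.r i z') φ z')) (c1.add c3)
      (fun φ => by
        have := cylPoint_periodic (M.r i z') z' φ
        simp only at this
        simp only [this])
      (fun k => by
        have h1 := h.coeff_laplaceBeltrami_eq hβ hβ' i k hz'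
        rw [circleCoeff_add c1 c3, circleCoeff, circleCoeff, fourierCoeffOn.const_mul]
        rw [coeff, coeff] at h1
        rw [h1]
        ring) θ
    linear_combination this
  have hcyl : ContinuousOn (fun z' => cylPoint (M.r i z') θ z')
      (Icc M.a (M.a + (M.b - M.a) * β)) := by
    have hr := (M.continuousOn_r i).mono (Icc_subset_Icc_right hle)
    have : ContinuousOn (fun z' : ℝ =>
        (![M.r i z' * Real.cos θ, M.r i z' * Real.sin θ, z'] : Fin 3 → ℝ))
        (Icc M.a (M.a + (M.b - M.a) * β)) := by
      rw [continuousOn_pi]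
      intro j
      fin_cases j
      · exact hr.mul continuousOn_const
      · exact hr.mul continuousOn_const
      · exact continuousOn_id
    exact (PiLp.continuousLinearEquiv 2 ℝ
      (fun _ : Fin 3 => ℝ)).symm.continuous.comp_continuousOn this
  have hmaps : MapsTo (fun z' => cylPoint (M.r i z') θ z')
      (Icc M.a (M.a + (M.b - M.a) * β)) M.carrier := fun z' hz' =>
    M.cylPoint_mem_carrier i (Icc_subset_Icc_right hle hz') θ
  have heq : EqOn (fun z' => laplaceBeltrami M.carrier f (cylPoint (M.r i z') θ z'))
      (fun z' => l * f (cylPoint (M.r i z') θ z')) (Icc M.a (M.a + (M.b - M.a) * β)) :=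
    EqOn.of_subset_closure (fun z' hz' => hint z' hz') (hΔ.comp hcyl hmaps)
      (continuousOn_const.mul (hf.comp hcyl hmaps)) Ioo_subset_Icc_self
      (by rw [closure_Ioo hlt.ne])
  exact heq hz

/-- `T_N(g)` depends only on the values of `g` on the circles met by the grid. -/
lemma quantize_eq_zero (hβ : 0 < β) {g : E3 → ℂ}
    (hg : ∀ i, ∀ z ∈ Icc M.a (M.a + (M.b - M.a) * β), ∀ θ, g (cylPoint (M.r i z) θ z) = 0) :
    M.quantize β N g = 0 := by
  ext u v
  have hN : 0 < N := lt_of_le_of_lt (Nat.zero_le _) u.2.2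
  rw [quantize, Matrix.of_apply, Matrix.zero_apply]
  split_ifs with h
  · have hh := M.hbar_pos hβ hN
    have hm := M.hbar_mul (β := β) hN
    have h1 : ((u.2 : ℕ) + 1 : ℝ) ≤ N := by exact_mod_cast u.2.2
    have h2 : ((v.2 : ℕ) + 1 : ℝ) ≤ N := by exact_mod_cast v.2.2
    have hz : M.height β N ((u.2 : ℕ) + 1) ((v.2 : ℕ) + 1) ∈
        Icc M.a (M.a + (M.b - M.a) * β) := by
      rw [height, ← hm]
      push_cast
      constructor
      · have : 0 ≤ M.hbar β N * (((u.2 : ℕ) + 1 + ((v.2 : ℕ) + 1) : ℝ) / 2) := by positivity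
        linarith
      · have : M.hbar β N * (((u.2 : ℕ) + 1 + ((v.2 : ℕ) + 1) : ℝ) / 2) ≤ M.hbar β N * N :=
          mul_le_mul_of_nonneg_left (by linarith) hh.le
        linarith
    have h0 := circleCoeff_smul 0 (fun _ => 0) ((u.2 : ℤ) - (v.2 : ℤ))
    simp only [zero_smul] at h0
    rw [coeff, ← h0, circleCoeff]
    congr 1
    funext θ
    exact hg u.1 _ hz θ
  · rfl

end AxialSurface

end

theorem mainTheorem1 {q : ℕ} (M : AxialSurface q) (β : ℝ) (hβ : 0 < β) (hβ' : β ≤ 1)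
    (F : (N : ℕ) → Matrix (Fin q × Fin N) (Fin q × Fin N) ℂ) (f : E3 → ℂ)
    (lam : ℕ → ℂ) (l : ℂ) (h : M.IsEigenmatrixSequence β F f lam l) :
    Tendsto
        (fun N => ‖M.quantize β N (fun p => laplaceBeltrami M.carrier f p - l * f p)‖)
        atTop (𝓝 0) ∧
      M.ConvergesTo β F f ∧
      (∀ p ∈ M.carrier, p 2 ≤ M.a + (M.b - M.a) * β → laplaceBeltrami M.carrier f p = l * f p) ∧
      (β = 1 → ∀ p ∈ M.carrier, laplaceBeltrami M.carrier f p = l * f p) ∧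
      ((∃ N, F N ≠ 0) → ∃ p ∈ M.carrier, f p ≠ 0) := by
  have hpart : ∀ p ∈ M.carrier, p 2 ≤ M.a + (M.b - M.a) * β →
      laplaceBeltrami M.carrier f p = l * f p := by
    rintro _ ⟨i, z, hz, θ, rfl⟩ hle
    exact h.laplaceBeltrami_eq hβ hβ' i θ ⟨hz.1, hle⟩
  refine ⟨?_, ?_, hpart, ?_, ?_⟩
  · -- the heights `z(n, m)` lie in `[a, a + (b - a) β]`, so these matrices vanish identically
    have h0 : ∀ N, M.quantize β N (fun p => laplaceBeltrami M.carrier f p - l * f p) = 0 :=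
      fun N => AxialSurface.quantize_eq_zero hβ fun i z hz θ =>
        sub_eq_zero.2 (h.laplaceBeltrami_eq hβ hβ' i θ hz)
    simp [h0]
  · simp [AxialSurface.ConvergesTo, h.eq_quantize]
  · rintro rfl _ ⟨i, z, hz, θ, rfl⟩
    refine hpart _ ⟨i, z, hz, θ, rfl⟩ ?_
    change z ≤ _
    linarith [hz.2]
  · rintro ⟨N, hN⟩
    by_contra! hzero
    refine hN ?_
    rw [h.eq_quantize N]
    refine AxialSurface.quantize_eq_zero hβ fun i z hz θ => hzero _ ?_
    refine M.cylPoint_mem_carrier i ⟨hz.1, hz.2.trans ?_⟩ θ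
    have := mul_le_mul_of_nonneg_left hβ' (sub_pos.2 M.a_lt_b).le
    linarith
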